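/- Let $P,Q$ be probability measures on a measurable space $\mathcal X$ with $P\ll Q$, and let $g_0=dP/dQ$ be the likelihood ratio. Let $X_1,X_2,\dots$ be i.i.d. from $P$ and $Y_1,Y_2,\dots$ i.i.d. from $Q$, defined on a common probability space with probability $\Pr$, and for $n\ge 1$ let $P_n=\frac1n\sum_{i=1}^n\delta_{X_i}$ and $Q_n=\frac1n\sum_{i=1}^n\delta_{Y_i}$ be the empirical distributions. Let $\mathcal G$ be a class of measurable functions $g:\mathcal X\to[0,\infty)$ that contains a function equal to $g_0$ $Q$-almost surely. For $\delta>0$ let $N^B_\delta(\mathcal G,L_2(Q))$ be the smallest $N$ for which there are $N$ pairs of measurable functions $(g_j^L,g_j^U)$ with $\|g_j^U-g_j^L\|_{L_2(Q)}\le\delta$ such that for every $g\in\mathcal G$ there is a $j$ with $g_j^L\le g\le g_j^U$ pointwise, and let $H^B_\delta(\mathcal G,L_2(Q))=\log N^B_\delta(\mathcal G,L_2(Q))$ be the entropy with bracketing. Assume that $\sup_{g\in\mathcal G}\sup_x |g(x)|<\infty$ and that for some constants $A$ and $0<\gamma<2$, $$H^B_\delta(\mathcal G,L_2(Q))\le A\,\delta^{-\gamma}\qquad\text{for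 all }\delta>0 .$$ For each $n\ge1$ let $\hat g_n$ be the least-squares estimator derived from the $\chi$-square divergence, that is, almost surely $$\hat g_n\in\operatorname*{argmax}_{g\in\mathcal G}\Big\{-\int g^2\,dQ_n+\int 2g\,dP_n\Big\}.$$ Then $\int (g-g_0)^2\,dQ<\infty$ for all $g\in\mathcal G$, and $$d_\chi(g_0,\hat g_n)=\int(\hat g_n-g_0)^2\,dQ=O_P\big(n^{-2/(\gamma+2)}\big),$$ that is, for every $\varepsilon>0$ there is a constant $C$ such that $\Pr\big(d_\chi(g_0,\hat g_n)>C\,n^{-2/(\gamma+2)}\big)\le\varepsilon$ for all $n\ge1$ (outer probability, if the event is not measurable). -/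

import Mathlib

open MeasureTheory ProbabilityTheory Filter
open scoped ENNReal

noncomputable section

/-- `N` pairs of measurable functions `(gL j, gU j)`, each of `L_r(Q)`-width at most `δ`, such that
every member of the class `G` lies pointwise between the two functions of some pair. -/
def HasBracketing {𝓧 : Type*} [MeasurableSpace 𝓧] (G : Set (𝓧 → ℝ)) (r : ℝ≥0∞)
    (Q : Measure 𝓧) (δ : ℝ) (N : ℕ) : Prop :=
  ∃ gL gU : Fin N → 𝓧 → ℝ,
    (∀ j, Measurable (gL j) ∧ Measurable (gU j)) ∧
    (∀ j, eLpNorm (gU j - gL j) r Q ≤ ENNReal.ofReal δ) ∧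
    ∀ g ∈ G, ∃ j, ∀ x, gL j x ≤ g x ∧ g x ≤ gU j x

/-- The `δ`-bracketing number of `G` in `L_r(Q)`: the smallest `N` for which there are `N` brackets
covering `G`, and `⊤` when finitely many brackets never suffice. -/
def bracketingNumber {𝓧 : Type*} [MeasurableSpace 𝓧] (G : Set (𝓧 → ℝ)) (r : ℝ≥0∞)
    (Q : Measure 𝓧) (δ : ℝ) : ℕ∞ :=
  sInf {m : ℕ∞ | ∃ N : ℕ, m = N ∧ HasBracketing G r Q δ N}

/-- The entropy with bracketing of `G` in `L_r(Q)`: the logarithm of the bracketing number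
(with `log ⊤ = ⊤`). -/
def bracketingEntropy {𝓧 : Type*} [MeasurableSpace 𝓧] (G : Set (𝓧 → ℝ)) (r : ℝ≥0∞)
    (Q : Measure 𝓧) (δ : ℝ) : EReal :=
  ENNReal.log (bracketingNumber G r Q δ : ℝ≥0∞)

/-- The likelihood ratio `g₀ = dP/dQ`. -/
def likelihoodRatio {𝓧 : Type*} [MeasurableSpace 𝓧] (P Q : Measure 𝓧) : 𝓧 → ℝ :=
  fun x => (P.rnDeriv Q x).toReal

/-- The empirical expectation `(1/n) ∑_{i < n} f(x_i)` of `f` over the first `n` sample points. -/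
def empiricalMean {𝓧 : Type*} (x : ℕ → 𝓧) (n : ℕ) (f : 𝓧 → ℝ) : ℝ :=
  (n : ℝ)⁻¹ * ∑ i ∈ Finset.range n, f (x i)

/-- The empirical least-squares criterion `-∫ g² dQ_n + ∫ 2 g dP_n`, where `P_n` is the empirical
distribution of `x_0, …, x_{n-1}` and `Q_n` that of `y_0, …, y_{n-1}`. -/
def chiSqCriterion {𝓧 : Type*} (x y : ℕ → 𝓧) (n : ℕ) (g : 𝓧 → ℝ) : ℝ :=
  -empiricalMean y n (fun t => g t ^ 2) + empiricalMean x n (fun t => 2 * g t)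

/-- `g` maximizes the empirical least-squares criterion over the class `G`. -/
def IsChiSqEstimate {𝓧 : Type*} (G : Set (𝓧 → ℝ)) (x y : ℕ → 𝓧) (n : ℕ) (g : 𝓧 → ℝ) : Prop :=
  g ∈ G ∧ IsMaxOn (chiSqCriterion x y n) G g

/-- The distance associated with the `χ`-square divergence, `∫ (g - g₀)² dQ`. -/
def chiSqDist {𝓧 : Type*} [MeasurableSpace 𝓧] (Q : Measure 𝓧) (g₀ g : 𝓧 → ℝ) : ℝ :=
  ∫ x, (g x - g₀ x) ^ 2 ∂Q

/-- `Z n = O_μ(r n)`, over `n ≥ 1`: the sequence `Z n / r n` is bounded in probability. For a set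
that is not measurable, `μ` is the outer probability, so no measurability of `Z n` is needed. -/
def IsBigOInProbability {Ω : Type*} [MeasurableSpace Ω] (μ : Measure Ω) (Z : ℕ → Ω → ℝ)
    (r : ℕ → ℝ) : Prop :=
  ∀ ε : ℝ, 0 < ε → ∃ C : ℝ, 0 < C ∧ ∀ n : ℕ, 1 ≤ n →
    μ {ω | C * r n < |Z n ω|} ≤ ENNReal.ofReal ε

end

/-! Write `gs` for the version of `g₀` in `G`. Since `∫ g dP = ∫ g·gs dQ`, the population criterion
`-∫ g² dQ + 2 ∫ g dP` equals `∫ gs² dQ - ∫ (g - gs)² dQ`. Comparing the empirical criterion at `ĝ`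
and at `gs` therefore bounds `d(g₀, ĝ)` by `|(Q_n - Q)(ĝ² - gs²)| + 2 |(P_n - P)(ĝ - gs)|`
(`chiSqDist_le_empiricalDeviation`). Uniform boundedness makes both increments of `L₂`-size `O(√d)`,
and transfers brackets of `G` in `L₂(Q)` to `L₂(P)` and to the squared class at the price of
constants.

The analytic core is `exists_modulus_of_entropy`: over an `L₂`-ball of radius `R` the expected
supremum of the empirical process is at most a constant times `R^(1 - γ/2) n^(-1/2)`, once `n
R^(2+γ)` is large enough. It comes from chaining along brackets of widths `R / 2^k`. Bernstein's
inequality controls each level, but needs sup-norm bounds, so a function leaves the chain at the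
first level where its bracket is wider than a threshold (`exists_integrable_bound_of_brackets`). The
level contributions form a geometric series exactly because `γ < 2`.

Finally the range of `d` is cut into dyadic shells. On the shell `d ≈ r²`, Markov's inequality gives
a probability of order `r^(-1-γ/2) n^(-1/2)`; this is of order one at `r = n^(-1/(γ+2))` and
summable over the shells beyond.

Suprema over the class need not be measurable, so each maximal inequality provides an integrable `W`
that dominates all deviations pointwise. -/

/-- The deviation `P_n h - P h` of the empirical mean of `h` from its expectation. -/
noncomputable def empiricalDeviation {𝓧 : Type*} [MeasurableSpace 𝓧] (P : Measure 𝓧) (x : ℕ → 𝓧)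
    (n : ℕ) (h : 𝓧 → ℝ) : ℝ :=
  empiricalMean x n h - ∫ t, h t ∂P

/-! ### Bernstein bounds and the maximal inequality for finite families -/

section MaximalInequality

variable {𝓧 Ω : Type*} [MeasurableSpace 𝓧] [MeasurableSpace Ω]
  {P : Measure 𝓧} {μ : Measure Ω}

theorem integrable_of_abs_le [IsProbabilityMeasure P]
    {h : 𝓧 → ℝ} {b : ℝ} (hm : Measurable h) (hb : ∀ x, |h x| ≤ b) :
    Integrable h P :=
  Integrable.of_bound hm.aestronglyMeasurable b (Eventually.of_forall hb)

theorem abs_integral_le_of_abs_le [IsProbabilityMeasure P]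
    {h : 𝓧 → ℝ} {b : ℝ} (hb : ∀ x, |h x| ≤ b) :
    |∫ x, h x ∂P| ≤ b := by
  have := norm_integral_le_of_norm_le_const (μ := P) (f := h) (C := b) (Eventually.of_forall hb)
  simpa using this

theorem abs_sub_integral_le [IsProbabilityMeasure P]
    {h : 𝓧 → ℝ} {b : ℝ} (hb : ∀ x, |h x| ≤ b) (x : 𝓧) :
    |h x - ∫ y, h y ∂P| ≤ 2 * b := by
  have h1 := abs_integral_le_of_abs_le (P := P) hb
  have h2 := abs_sub (h x) (∫ y, h y ∂P)
  linarith [hb x]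

/-- Bernstein's bound for the moment generating function of a centred bounded function. -/
theorem integral_exp_mul_centered_le [IsProbabilityMeasure P]
    {h : 𝓧 → ℝ} {b v t : ℝ} (hm : Measurable h)
    (hb : ∀ x, |h x| ≤ b) (ht : |t| * (2 * b) ≤ 1) (hv : ∫ x, h x ^ 2 ∂P ≤ v) :
    ∫ x, Real.exp (t * (h x - ∫ y, h y ∂P)) ∂P ≤ Real.exp (t ^ 2 * v) := by
  set m := ∫ y, h y ∂P with hmdef
  have hi : Integrable h P := integrable_of_abs_le hm hb
  have hcent : ∀ x, |t * (h x - m)| ≤ 1 := fun x => by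
    rw [abs_mul]
    exact (mul_le_mul_of_nonneg_left (abs_sub_integral_le hb x) (abs_nonneg t)).trans ht
  have hsq : Integrable (fun x => h x ^ 2) P :=
    integrable_of_abs_le (b := b ^ 2) (hm.pow_const 2) fun x => by
      rw [abs_pow]; exact pow_le_pow_left₀ (abs_nonneg _) (hb x) 2
  -- `exp y ≤ 1 + y + y²` for `|y| ≤ 1`; the linear term will integrate to zero by centring.
  have hle : ∀ x, Real.exp (t * (h x - m)) ≤ 1 + t * (h x - m) + t ^ 2 * (h x - m) ^ 2 :=
    fun x => by
      have := (abs_le.mp (Real.abs_exp_sub_one_sub_id_le (hcent x))).2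
      nlinarith
  have hexp : Integrable (fun x => Real.exp (t * (h x - m))) P :=
    integrable_of_abs_le (b := Real.exp 1) (by fun_prop) fun x => by
      rw [abs_of_pos (Real.exp_pos _)]
      exact Real.exp_le_exp.mpr (abs_le.mp (hcent x)).2
  have hcsq : Integrable (fun x => (h x - m) ^ 2) P := by
    have : (fun x => (h x - m) ^ 2) = fun x => h x ^ 2 - 2 * m * h x + m ^ 2 := by
      ext x; ring
    rw [this]
    exact (hsq.sub (hi.const_mul _)).add (integrable_const _)
  have hcint : ∫ x, (h x - m) ^ 2 ∂P = ∫ x, h x ^ 2 ∂P - m ^ 2 := by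
    have : (fun x => (h x - m) ^ 2) = fun x => h x ^ 2 - 2 * m * h x + m ^ 2 := by
      ext x; ring
    have hi1 : Integrable (fun x => 2 * m * h x) P := hi.const_mul _
    have hi2 : Integrable (fun x => h x ^ 2 - 2 * m * h x) P := hsq.sub hi1
    rw [this, integral_add hi2 (integrable_const _), integral_sub hsq hi1, integral_const_mul,
      ← hmdef]
    simp
    ring
  have hcent0 : ∫ x, (h x - m) ∂P = 0 := by
    rw [integral_sub hi (integrable_const _)]
    simp [hmdef]
  have hi1 : Integrable (fun x => t * (h x - m)) P := (hi.sub (integrable_const m)).const_mul t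
  have hi2 : Integrable (fun x => 1 + t * (h x - m)) P := (integrable_const _).add hi1
  have hi3 : Integrable (fun x => t ^ 2 * (h x - m) ^ 2) P := hcsq.const_mul _
  calc ∫ x, Real.exp (t * (h x - m)) ∂P
      ≤ ∫ x, (1 + t * (h x - m) + t ^ 2 * (h x - m) ^ 2) ∂P :=
        integral_mono hexp (hi2.add hi3) hle
    _ = 1 + t ^ 2 * (∫ x, h x ^ 2 ∂P - m ^ 2) := by
        rw [integral_add hi2 hi3, integral_add (integrable_const _) hi1, integral_const_mul,
          integral_const_mul, hcint]
        simp [hcent0]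
    _ ≤ 1 + t ^ 2 * v := by
        have : ∫ x, h x ^ 2 ∂P - m ^ 2 ≤ v := by nlinarith [sq_nonneg m]
        linarith [mul_le_mul_of_nonneg_left this (sq_nonneg t)]
    _ ≤ Real.exp (t ^ 2 * v) := by linarith [Real.add_one_le_exp (t ^ 2 * v)]

theorem mul_empiricalDeviation_eq (x : ℕ → 𝓧) {n : ℕ} (hn : 1 ≤ n) (h : 𝓧 → ℝ) :
    n * empiricalDeviation P x n h = ∑ i ∈ Finset.range n, (h (x i) - ∫ y, h y ∂P) := by
  have : (n : ℝ) ≠ 0 := by positivity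
  simp only [empiricalDeviation, empiricalMean, Finset.sum_sub_distrib, Finset.sum_const,
    Finset.card_range, nsmul_eq_mul]
  field_simp

theorem abs_empiricalDeviation_le [IsProbabilityMeasure P]
    (x : ℕ → 𝓧) {n : ℕ} (hn : 1 ≤ n) {h : 𝓧 → ℝ} {b : ℝ}
    (hb : ∀ x, |h x| ≤ b) : |empiricalDeviation P x n h| ≤ 2 * b := by
  have hn0 : (0 : ℝ) < n := by positivity
  have h1 : |n * empiricalDeviation P x n h| ≤ n * (2 * b) := by
    rw [mul_empiricalDeviation_eq x hn]
    refine (Finset.abs_sum_le_sum_abs _ _).trans ?_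
    refine (Finset.sum_le_sum fun i _ => abs_sub_integral_le hb (x i)).trans ?_
    simp
  rw [abs_mul, abs_of_pos hn0] at h1
  exact le_of_mul_le_mul_left h1 hn0

variable {X : ℕ → Ω → 𝓧}

theorem aemeasurable_empiricalDeviation (hX : ∀ i, HasLaw (X i) P μ) (n : ℕ) {h : 𝓧 → ℝ}
    (hm : Measurable h) :
    AEMeasurable (fun ω => empiricalDeviation P (fun i => X i ω) n h) μ := by
  unfold empiricalDeviation empiricalMean
  refine AEMeasurable.sub_const (AEMeasurable.const_mul ?_ _) _
  exact Finset.aemeasurable_fun_sum _ fun i _ => hm.comp_aemeasurable (hX i).aemeasurable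

/-- Bernstein's bound for the moment generating function of the empirical process. -/
theorem integral_exp_mul_empiricalDeviation_le [IsProbabilityMeasure P] (hX : ∀ i, HasLaw (X i) P μ)
    (hind : iIndepFun X μ) {n : ℕ} (hn : 1 ≤ n) {h : 𝓧 → ℝ} {b v t : ℝ} (hm : Measurable h)
    (hb : ∀ x, |h x| ≤ b) (ht : |t| * (2 * b) ≤ 1) (hv : ∫ x, h x ^ 2 ∂P ≤ v) :
    ∫ ω, Real.exp (t * (n * empiricalDeviation P (fun i => X i ω) n h)) ∂μ
      ≤ Real.exp (n * (t ^ 2 * v)) := by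
  let c : 𝓧 → ℝ := fun x => h x - ∫ y, h y ∂P
  have hc : Measurable c := hm.sub_const _
  have hmgf := (hind.comp (fun _ => c) fun _ => hc).mgf_sum₀ (t := t)
    (fun i => hc.comp_aemeasurable (hX i).aemeasurable) (Finset.range n)
  have hone : ∀ i, mgf (c ∘ X i) μ t ≤ Real.exp (t ^ 2 * v) := fun i => by
    have hcomp := (hX i).integral_comp (f := fun x => Real.exp (t * c x))
      (by fun_prop)
    have : mgf (c ∘ X i) μ t = ∫ x, Real.exp (t * c x) ∂P := hcomp
    rw [this]
    exact integral_exp_mul_centered_le hm hb ht hv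
  calc ∫ ω, Real.exp (t * (n * empiricalDeviation P (fun i => X i ω) n h)) ∂μ
      = mgf (∑ i ∈ Finset.range n, c ∘ X i) μ t := by
        simp only [mgf, mul_empiricalDeviation_eq _ hn]
        simp [c]
    _ = ∏ i ∈ Finset.range n, mgf (c ∘ X i) μ t := hmgf
    _ ≤ ∏ _i ∈ Finset.range n, Real.exp (t ^ 2 * v) :=
        Finset.prod_le_prod (fun i _ => mgf_nonneg) fun i _ => hone i
    _ = Real.exp (n * (t ^ 2 * v)) := by
        rw [Finset.prod_const, Finset.card_range, ← Real.exp_nat_mul]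

/-- A maximal inequality for finitely many functions: the deviations over the family `h` are
dominated by one random variable whose expectation is controlled by the entropy `ℓ`. -/
theorem exists_integrable_bound_of_finite [IsProbabilityMeasure P] [IsProbabilityMeasure μ]
    (hX : ∀ i, HasLaw (X i) P μ) (hind : iIndepFun X μ)
    {n : ℕ} (hn : 1 ≤ n) {I T : Type*} [Fintype T] (κ : I → T) (h : I → 𝓧 → ℝ)
    (hκ : ∀ i i', κ i = κ i' → h i = h i') {ℓ b v τ : ℝ}
    (hcard : 2 * (Fintype.card T : ℝ) ≤ Real.exp ℓ) (hm : ∀ i, Measurable (h i))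
    (hb : ∀ i x, |h i x| ≤ b) (hv : ∀ i, ∫ x, h i x ^ 2 ∂P ≤ v) (hτ0 : 0 < τ)
    (hτ : τ * (2 * b) ≤ 1) :
    ∃ W : Ω → ℝ, Integrable W μ ∧
      (∀ i ω, |empiricalDeviation P (fun k => X k ω) n (h i)| ≤ W ω) ∧
      ∫ ω, W ω ∂μ ≤ ℓ / (n * τ) + τ * v := by
  classical
  have hn0 : (0 : ℝ) < n := by positivity
  -- The index type may be infinite, but `h` factors through `κ`, so at most `card T` distinct
  -- functions occur.
  have hfin : (Set.range h).Finite := by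
    have : Set.range h ⊆ (fun t : T => if ht : ∃ i, κ i = t then h ht.choose else 0) '' Set.univ := by
      rintro _ ⟨i, rfl⟩
      have ht : ∃ i', κ i' = κ i := ⟨i, rfl⟩
      refine ⟨κ i, Set.mem_univ _, ?_⟩
      simp only [ht, dif_pos]
      exact hκ _ _ ht.choose_spec
    exact Set.Finite.subset (Set.toFinite _) this
  set S := hfin.toFinset with hS
  have hScard : (S.card : ℝ) ≤ Fintype.card T := by
    have : S ⊆ Finset.univ.image
        (fun t : T => if ht : ∃ i, κ i = t then h ht.choose else 0) := by
      intro g hg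
      obtain ⟨i, rfl⟩ := hfin.mem_toFinset.mp hg
      have ht : ∃ i', κ i' = κ i := ⟨i, rfl⟩
      refine Finset.mem_image.mpr ⟨κ i, Finset.mem_univ _, ?_⟩
      simp only [ht, dif_pos]
      exact hκ _ _ ht.choose_spec
    exact_mod_cast (Finset.card_le_card this).trans Finset.card_image_le
  have hSprop : ∀ g ∈ S, Measurable g ∧ (∀ x, |g x| ≤ b) ∧ ∫ x, g x ^ 2 ∂P ≤ v := by
    intro g hg
    obtain ⟨i, rfl⟩ := hfin.mem_toFinset.mp hg
    exact ⟨hm i, hb i, hv i⟩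
  let D : (𝓧 → ℝ) → Ω → ℝ := fun g ω => n * empiricalDeviation P (fun k => X k ω) n g
  let Z : Ω → ℝ := fun ω => ∑ g ∈ S, (Real.exp (τ * D g ω) + Real.exp (-τ * D g ω))
  set L := ℓ + n * (τ ^ 2 * v) with hL
  have hint : ∀ g ∈ S, ∀ t, Integrable (fun ω => Real.exp (t * D g ω)) μ := by
    intro g hg t
    obtain ⟨h1, h2, -⟩ := hSprop g hg
    refine Integrable.of_bound (C := Real.exp (|t| * (n * (2 * b)))) ?_ ?_
    · exact (Real.measurable_exp.comp_aemeasurable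
        (((aemeasurable_empiricalDeviation hX n h1).const_mul _).const_mul _)).aestronglyMeasurable
    · refine Eventually.of_forall fun ω => ?_
      rw [Real.norm_eq_abs, abs_of_pos (Real.exp_pos _)]
      refine Real.exp_le_exp.mpr ((le_abs_self _).trans ?_)
      rw [abs_mul, abs_mul, abs_of_pos hn0]
      exact mul_le_mul_of_nonneg_left (mul_le_mul_of_nonneg_left
        (abs_empiricalDeviation_le _ hn h2) hn0.le) (abs_nonneg t)
  have hZint : Integrable Z μ :=
    integrable_finsetSum _ fun g hg => (hint g hg τ).add (hint g hg (-τ))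
  have hZ : ∫ ω, Z ω ∂μ ≤ Real.exp L := by
    have hterm : ∀ g ∈ S, ∫ ω, (Real.exp (τ * D g ω) + Real.exp (-τ * D g ω)) ∂μ
        ≤ 2 * Real.exp (n * (τ ^ 2 * v)) := by
      intro g hg
      obtain ⟨h1, h2, h3⟩ := hSprop g hg
      rw [integral_add (hint g hg τ) (hint g hg (-τ))]
      have e1 := integral_exp_mul_empiricalDeviation_le hX hind hn h1 h2 (t := τ)
        (by rwa [abs_of_pos hτ0]) h3
      have e2 := integral_exp_mul_empiricalDeviation_le hX hind hn h1 h2 (t := -τ)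
        (by rwa [abs_neg, abs_of_pos hτ0]) h3
      rw [neg_sq] at e2
      linarith
    calc ∫ ω, Z ω ∂μ = ∑ g ∈ S, ∫ ω, (Real.exp (τ * D g ω) + Real.exp (-τ * D g ω)) ∂μ :=
          integral_finsetSum _ fun g hg => (hint g hg τ).add (hint g hg (-τ))
      _ ≤ ∑ _g ∈ S, 2 * Real.exp (n * (τ ^ 2 * v)) := Finset.sum_le_sum hterm
      _ = (2 * S.card) * Real.exp (n * (τ ^ 2 * v)) := by
          rw [Finset.sum_const, nsmul_eq_mul]; ring
      _ ≤ Real.exp ℓ * Real.exp (n * (τ ^ 2 * v)) := by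
          refine mul_le_mul_of_nonneg_right ?_ (Real.exp_pos _).le
          linarith
      _ = Real.exp L := (Real.exp_add _ _).symm
  -- Since `exp |τ D| ≤ Z`, one would like to use `log Z`. Its tangent line at `exp L`, namely `L +
  -- Z / exp L - 1`, lies above it, is integrable because `Z` is, and has mean at most `L`; this
  -- replaces Jensen's inequality.
  refine ⟨fun ω => (n * τ)⁻¹ * (L + (Z ω / Real.exp L - 1)), ?_, ?_, ?_⟩
  · exact ((integrable_const _).add ((hZint.div_const _).sub (integrable_const _))).const_mul _
  · intro i ω
    have hi : h i ∈ S := hfin.mem_toFinset.mpr ⟨i, rfl⟩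
    have hle : Real.exp (|τ * D (h i) ω|) ≤ Z ω := by
      refine le_trans ?_ (Finset.single_le_sum
        (f := fun g => Real.exp (τ * D g ω) + Real.exp (-τ * D g ω)) (fun g _ => by positivity) hi)
      rcases abs_cases (τ * D (h i) ω) with ⟨h1, -⟩ | ⟨h1, -⟩
      · rw [h1]; linarith [Real.exp_pos (-τ * D (h i) ω)]
      · rw [h1, neg_mul]; linarith [Real.exp_pos (τ * D (h i) ω)]
    have hexp : |τ * D (h i) ω| - L + 1 ≤ Z ω / Real.exp L := by
      refine (Real.add_one_le_exp _).trans ?_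
      rw [Real.exp_sub]
      exact div_le_div_of_nonneg_right hle (Real.exp_pos _).le
    have habs : |τ * D (h i) ω| = n * τ * |empiricalDeviation P (fun k => X k ω) n (h i)| := by
      simp only [D]
      rw [abs_mul, abs_mul, abs_of_pos hn0, abs_of_pos hτ0]; ring
    beta_reduce
    rw [← div_eq_inv_mul, le_div_iff₀ (by positivity)]
    rw [habs] at hexp
    linarith
  · have hi1 : Integrable (fun ω => Z ω / Real.exp L) μ := hZint.div_const _
    have hi2 : Integrable (fun ω => Z ω / Real.exp L - 1) μ := hi1.sub (integrable_const _)
    rw [integral_const_mul, integral_add (integrable_const _) hi2,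
      integral_sub hi1 (integrable_const _), integral_div]
    simp only [integral_const, probReal_univ, smul_eq_mul, one_mul]
    have : (∫ ω, Z ω ∂μ) / Real.exp L ≤ 1 := by
      rw [div_le_one (Real.exp_pos _)]; exact hZ
    have h2 : ℓ / (n * τ) + τ * v = (n * τ)⁻¹ * L := by
      rw [hL]; field_simp
    rw [h2]
    exact mul_le_mul_of_nonneg_left (by linarith) (by positivity)

end MaximalInequality

/-! ### Bracket widths as integrals, and bounded brackets -/

section Brackets

variable {𝓧 : Type*} [MeasurableSpace 𝓧] {P : Measure 𝓧}

theorem integral_sq_le_of_eLpNorm_le {w : 𝓧 → ℝ} {δ : ℝ} (hδ : 0 ≤ δ) (hw : Measurable w)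
    (h : eLpNorm w 2 P ≤ ENNReal.ofReal δ) : ∫ x, w x ^ 2 ∂P ≤ δ ^ 2 := by
  rw [integral_eq_lintegral_of_nonneg_ae (Eventually.of_forall fun x => sq_nonneg _)
    (hw.pow_const 2).aestronglyMeasurable]
  refine ENNReal.toReal_le_of_le_ofReal (sq_nonneg δ) ?_
  have h2 := eLpNorm_nnreal_pow_eq_lintegral (f := w) (μ := P) (p := 2) (by norm_num)
  have h3 : ∀ x, ENNReal.ofReal (w x ^ 2) = ‖w x‖ₑ ^ ((2 : NNReal) : ℝ) := fun x => by
    rw [← sq_abs, ENNReal.ofReal_pow (abs_nonneg _), ← Real.norm_eq_abs, ofReal_norm]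
    norm_num
  simp_rw [h3]
  rw [← h2, ENNReal.ofReal_pow hδ]
  have : ((2 : NNReal) : ℝ) = ((2 : ℕ) : ℝ) := by norm_num
  rw [this, ENNReal.rpow_natCast]
  exact pow_le_pow_left' h 2

theorem eLpNorm_le_ofReal_of_integral_sq_le {w : 𝓧 → ℝ} {δ : ℝ} (hδ : 0 ≤ δ)
    (hi : Integrable (fun x => w x ^ 2) P) (h : ∫ x, w x ^ 2 ∂P ≤ δ ^ 2) :
    eLpNorm w 2 P ≤ ENNReal.ofReal δ := by
  have h2 := eLpNorm_nnreal_pow_eq_lintegral (f := w) (μ := P) (p := 2) (by norm_num)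
  have h3 : ∀ x, ENNReal.ofReal (w x ^ 2) = ‖w x‖ₑ ^ ((2 : NNReal) : ℝ) := fun x => by
    rw [← sq_abs, ENNReal.ofReal_pow (abs_nonneg _), ← Real.norm_eq_abs, ofReal_norm]
    norm_num
  have h4 := ofReal_integral_eq_lintegral_ofReal hi (Eventually.of_forall fun x => sq_nonneg _)
  simp_rw [h3] at h4
  rw [← h2] at h4
  have h5 := ENNReal.ofReal_le_ofReal h
  rw [h4, ENNReal.ofReal_pow hδ, ← ENNReal.rpow_natCast] at h5
  have : ((2 : NNReal) : ℝ) = ((2 : ℕ) : ℝ) := by norm_num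
  erw [this] at h5
  exact (ENNReal.rpow_le_rpow_iff (by norm_num)).mp h5

/-- Truncation of `y` to the interval `[a, b]`. -/
def clamp (a b y : ℝ) : ℝ := max a (min b y)

theorem clamp_mono {a b y z : ℝ} (h : y ≤ z) : clamp a b y ≤ clamp a b z :=
  max_le_max le_rfl (min_le_min le_rfl h)

theorem le_clamp (a b y : ℝ) : a ≤ clamp a b y := le_max_left _ _

theorem clamp_le {a b : ℝ} (hab : a ≤ b) (y : ℝ) : clamp a b y ≤ b :=
  max_le hab (min_le_left _ _)

theorem clamp_eq_self {a b y : ℝ} (h1 : a ≤ y) (h2 : y ≤ b) : clamp a b y = y := by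
  rw [clamp, min_eq_right h2, max_eq_right h1]

theorem abs_clamp_sub_clamp_le (a b y z : ℝ) : |clamp a b y - clamp a b z| ≤ |y - z| := by
  unfold clamp
  have h1 := abs_max_sub_max_le_max a (min b y) a (min b z)
  have h2 := abs_min_sub_min_le_max b y b z
  rw [sub_self, abs_zero, max_eq_right (abs_nonneg (min b y - min b z))] at h1
  rw [sub_self, abs_zero, max_eq_right (abs_nonneg (y - z))] at h2
  exact h1.trans h2

theorem measurable_clamp {a b : ℝ} {h : 𝓧 → ℝ} (hm : Measurable h) :
    Measurable fun x => clamp a b (h x) :=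
  measurable_const.max (measurable_const.min hm)

/-- Brackets of a uniformly bounded class can be taken uniformly bounded. -/
theorem HasBracketing.exists_bounded {F : Set (𝓧 → ℝ)} {δ K : ℝ} {N : ℕ} (hK : 0 ≤ K) (hδ : 0 ≤ δ)
    (hF : ∀ f ∈ F, ∀ x, |f x| ≤ K) (h : HasBracketing F 2 P δ N) :
    ∃ l u : Fin N → 𝓧 → ℝ, (∀ j, Measurable (l j)) ∧ (∀ j, Measurable (u j)) ∧
      (∀ j x, |l j x| ≤ K) ∧ (∀ j x, |u j x| ≤ K) ∧
      (∀ j, ∫ x, (u j x - l j x) ^ 2 ∂P ≤ δ ^ 2) ∧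
      ∀ f ∈ F, ∃ j, ∀ x, l j x ≤ f x ∧ f x ≤ u j x := by
  obtain ⟨gL, gU, hm, hw, hc⟩ := h
  have hKK : -K ≤ K := by linarith
  -- Truncation to `[-K, K]` is monotone and 1-Lipschitz and fixes the values of `F`: brackets stay
  -- brackets and do not widen.
  refine ⟨fun j x => clamp (-K) K (gL j x), fun j x => clamp (-K) K (gU j x),
    fun j => measurable_clamp (hm j).1, fun j => measurable_clamp (hm j).2,
    fun j x => abs_le.mpr ⟨le_clamp _ _ _, clamp_le hKK _⟩,
    fun j x => abs_le.mpr ⟨le_clamp _ _ _, clamp_le hKK _⟩, fun j => ?_, fun f hf => ?_⟩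
  · refine integral_sq_le_of_eLpNorm_le hδ
      ((measurable_clamp (hm j).2).sub (measurable_clamp (hm j).1)) (le_trans ?_ (hw j))
    exact eLpNorm_mono fun x => abs_clamp_sub_clamp_le _ _ _ _
  · obtain ⟨j, hj⟩ := hc f hf
    refine ⟨j, fun x => ?_⟩
    have h1 := abs_le.mp (hF f hf x)
    rw [← clamp_eq_self h1.1 h1.2]
    exact ⟨clamp_mono (hj x).1, clamp_mono (hj x).2⟩

end Brackets

/-! ### Elementary properties of the deviation -/

section Deviation

variable {𝓧 : Type*} [MeasurableSpace 𝓧] {P : Measure 𝓧}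

theorem empiricalDeviation_add (x : ℕ → 𝓧) (n : ℕ) {h₁ h₂ : 𝓧 → ℝ} (hi₁ : Integrable h₁ P)
    (hi₂ : Integrable h₂ P) :
    empiricalDeviation P x n (fun t => h₁ t + h₂ t)
      = empiricalDeviation P x n h₁ + empiricalDeviation P x n h₂ := by
  unfold empiricalDeviation empiricalMean
  rw [integral_add hi₁ hi₂, Finset.sum_add_distrib]
  ring

/-- Both `P_n h₁` and `P h₁` lie between `0` and the corresponding mean of `h₂`. This replaces an
arbitrary remainder by a bracket width, one of finitely many functions, at the cost of the mean
width. -/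
theorem abs_empiricalDeviation_le_of_le (x : ℕ → 𝓧) (n : ℕ) {h₁ h₂ : 𝓧 → ℝ}
    (hi₁ : Integrable h₁ P) (hi₂ : Integrable h₂ P) (h0 : ∀ t, 0 ≤ h₁ t) (hle : ∀ t, h₁ t ≤ h₂ t) :
    |empiricalDeviation P x n h₁| ≤ |empiricalDeviation P x n h₂| + ∫ t, h₂ t ∂P := by
  have e1 : empiricalMean x n h₁ ≤ empiricalMean x n h₂ :=
    mul_le_mul_of_nonneg_left (Finset.sum_le_sum fun i _ => hle _) (by positivity)
  have e2 : 0 ≤ empiricalMean x n h₁ :=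
    mul_nonneg (by positivity) (Finset.sum_nonneg fun i _ => h0 _)
  have e3 : ∫ t, h₁ t ∂P ≤ ∫ t, h₂ t ∂P := integral_mono hi₁ hi₂ hle
  have e4 : 0 ≤ ∫ t, h₁ t ∂P := integral_nonneg h0
  have e5 := le_abs_self (empiricalDeviation P x n h₂)
  have e6 := abs_nonneg (empiricalDeviation P x n h₂)
  unfold empiricalDeviation at *
  rw [abs_le]
  constructor <;> linarith

end Deviation

/-! ### Adaptive truncation by bracket width -/

section Truncation

variable {𝓧 : Type*}

/-- The indicator that the bracket widths `d 1, …, d k` are below the thresholds `a 1, …, a k`. -/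
noncomputable def widthIndicator (a : ℕ → ℝ) (d : ℕ → 𝓧 → ℝ) (k : ℕ) (x : 𝓧) : ℝ :=
  ∏ i ∈ Finset.range k, if d (i + 1) x ≤ a (i + 1) then 1 else 0

theorem widthIndicator_zero (a : ℕ → ℝ) (d : ℕ → 𝓧 → ℝ) (x : 𝓧) : widthIndicator a d 0 x = 1 := by
  simp [widthIndicator]

theorem widthIndicator_succ (a : ℕ → ℝ) (d : ℕ → 𝓧 → ℝ) (k : ℕ) (x : 𝓧) :
    widthIndicator a d (k + 1) x
      = widthIndicator a d k x * if d (k + 1) x ≤ a (k + 1) then 1 else 0 :=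
  Finset.prod_range_succ _ _

theorem widthIndicator_eq_zero_or_one (a : ℕ → ℝ) (d : ℕ → 𝓧 → ℝ) (k : ℕ) (x : 𝓧) :
    widthIndicator a d k x = 0 ∨ widthIndicator a d k x = 1 := by
  induction k with
  | zero => exact Or.inr (widthIndicator_zero a d x)
  | succ k ih =>
    rw [widthIndicator_succ]
    rcases ih with h | h <;> rw [h] <;> split_ifs <;> simp

theorem le_of_widthIndicator_eq_one {a : ℕ → ℝ} {d : ℕ → 𝓧 → ℝ} {k : ℕ} {x : 𝓧}
    (h0 : d 0 x ≤ a 0) (h : widthIndicator a d k x = 1) : d k x ≤ a k := by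
  cases k with
  | zero => exact h0
  | succ k =>
    rw [widthIndicator_succ] at h
    by_contra hc
    simp [hc] at h

theorem measurable_widthIndicator [MeasurableSpace 𝓧] {a : ℕ → ℝ} {d : ℕ → 𝓧 → ℝ}
    (hd : ∀ i, Measurable (d i)) (k : ℕ) : Measurable (widthIndicator a d k) := by
  unfold widthIndicator
  exact Finset.measurable_fun_prod _ fun i _ =>
    Measurable.ite (measurableSet_le (hd _) measurable_const) measurable_const measurable_const

/-- Ensures that truncated functions depend only on the brackets chosen up to level `k`, so that
they can be counted. -/
theorem widthIndicator_congr (a : ℕ → ℝ) {d d' : ℕ → 𝓧 → ℝ} {k : ℕ}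
    (h : ∀ i ≤ k, d i = d' i) : widthIndicator a d k = widthIndicator a d' k := by
  funext x
  refine Finset.prod_congr rfl fun i hi => ?_
  rw [h (i + 1) (Finset.mem_range.mp hi)]

/-- The difference of indicators is supported where the chain stops: `d k ≤ a k` still holds but `d
(k+1) > a (k+1)`. There `d k * a (k+1) ≤ d k * d (k+1)`, and the last bound follows by the
arithmetic-geometric mean inequality; its integral is small although only `L₂` widths are known. -/
theorem width_term_bounds {a : ℕ → ℝ} {d : ℕ → 𝓧 → ℝ} {k : ℕ} {x : 𝓧} (ha : ∀ i, 0 < a i)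
    (hd : ∀ i, 0 ≤ d i x) (h0 : d 0 x ≤ a 0) :
    0 ≤ d k x * (widthIndicator a d k x - widthIndicator a d (k + 1) x) ∧
    d k x * (widthIndicator a d k x - widthIndicator a d (k + 1) x) ≤ a k ∧
    d k x * (widthIndicator a d k x - widthIndicator a d (k + 1) x) ≤ d k x ∧
    d k x * (widthIndicator a d k x - widthIndicator a d (k + 1) x)
      ≤ (d k x ^ 2 + d (k + 1) x ^ 2) / (2 * a (k + 1)) := by
  have hpos : 0 ≤ (d k x ^ 2 + d (k + 1) x ^ 2) / (2 * a (k + 1)) := by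
    have := ha (k + 1); positivity
  rw [widthIndicator_succ]
  rcases widthIndicator_eq_zero_or_one a d k x with h | h
  · rw [h]; simp only [zero_mul, sub_zero, mul_zero]
    exact ⟨le_rfl, (ha k).le, hd k, hpos⟩
  · have hk := le_of_widthIndicator_eq_one h0 h
    rw [h]
    split_ifs with hc
    · simp only [mul_one, sub_self, mul_zero]
      exact ⟨le_rfl, (ha k).le, hd k, hpos⟩
    · simp only [mul_zero, sub_zero, mul_one]
      refine ⟨hd k, hk, le_rfl, ?_⟩
      rw [le_div_iff₀ (by linarith [ha (k + 1)])]
      have := mul_le_mul_of_nonneg_left (not_le.mp hc).le (hd k)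
      nlinarith [sq_nonneg (d k x - d (k + 1) x)]

/-- Both brackets contain `f`, so `l (k+1) - l k` is at most the width at level `k` and at least
minus the width at level `k+1`. The brackets need not be nested. -/
theorem link_term_bounds {a : ℕ → ℝ} {l u : ℕ → 𝓧 → ℝ} {f : 𝓧 → ℝ} {k : ℕ} {x : 𝓧}
    (ha : ∀ i, 0 < a i) (hmono : a (k + 1) ≤ a k) (hl : ∀ i, l i x ≤ f x) (hu : ∀ i, f x ≤ u i x)
    (h0 : u 0 x - l 0 x ≤ a 0) :
    |(l (k + 1) x - l k x) * widthIndicator a (fun i t => u i t - l i t) (k + 1) x| ≤ a k ∧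
    ((l (k + 1) x - l k x) * widthIndicator a (fun i t => u i t - l i t) (k + 1) x) ^ 2
      ≤ (u k x - l k x) ^ 2 + (u (k + 1) x - l (k + 1) x) ^ 2 := by
  have h1 := hl k
  have h2 := hu k
  have h3 := hl (k + 1)
  have h4 := hu (k + 1)
  rcases widthIndicator_eq_zero_or_one a (fun i t => u i t - l i t) (k + 1) x with h | h
  · rw [h]; simp only [mul_zero, abs_zero, zero_pow two_ne_zero]
    exact ⟨(ha k).le, by positivity⟩
  · have hk1 := le_of_widthIndicator_eq_one h0 h
    have hk : u k x - l k x ≤ a k := by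
      rw [widthIndicator_succ] at h
      refine le_of_widthIndicator_eq_one (d := fun i t => u i t - l i t) h0 ?_
      rcases widthIndicator_eq_zero_or_one a (fun i t => u i t - l i t) k x with h' | h'
      · simp [h'] at h
      · exact h'
    rw [h, mul_one]
    refine ⟨abs_le.mpr ⟨by linarith, by linarith⟩, ?_⟩
    rcases le_total (l k x) (l (k + 1) x) with hle | hle
    · nlinarith [sq_nonneg (u (k + 1) x - l (k + 1) x)]
    · nlinarith [sq_nonneg (u k x - l k x)]

end Truncation

/-! ### The chaining decomposition and the number of chains -/

section Chaining

variable {𝓧 Ω : Type*} [MeasurableSpace 𝓧] [MeasurableSpace Ω] {P : Measure 𝓧} {μ : Measure Ω}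

/-- One function, one sample: chaining along brackets with adaptive truncation. -/
theorem abs_empiricalDeviation_chain_le [IsProbabilityMeasure P] (x : ℕ → 𝓧) (n : ℕ) {K : ℝ}
    {f f₀ : 𝓧 → ℝ}
    (hf : Measurable f) (hf₀ : Measurable f₀) (hfK : ∀ t, |f t| ≤ K) (hf₀K : ∀ t, |f₀ t| ≤ K)
    {l u : ℕ → 𝓧 → ℝ} (hl : ∀ i, Measurable (l i)) (hu : ∀ i, Measurable (u i))
    (hlK : ∀ i t, |l i t| ≤ K) (huK : ∀ i t, |u i t| ≤ K)
    (hlf : ∀ i t, l i t ≤ f t) (hfu : ∀ i t, f t ≤ u i t) (a : ℕ → ℝ) (m : ℕ) :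
    |empiricalDeviation P x n (fun t => f t - f₀ t)| ≤
      |empiricalDeviation P x n (fun t => l 0 t - f₀ t)|
      + ∑ k ∈ Finset.range m,
        (|empiricalDeviation P x n (fun t => (u k t - l k t) *
            (widthIndicator a (fun i t => u i t - l i t) k t
              - widthIndicator a (fun i t => u i t - l i t) (k + 1) t))|
          + ∫ t, (u k t - l k t) * (widthIndicator a (fun i t => u i t - l i t) k t
              - widthIndicator a (fun i t => u i t - l i t) (k + 1) t) ∂P
          + |empiricalDeviation P x n (fun t => (l (k + 1) t - l k t) *
              widthIndicator a (fun i t => u i t - l i t) (k + 1) t)|)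
      + (|empiricalDeviation P x n (fun t => (u m t - l m t) *
            widthIndicator a (fun i t => u i t - l i t) m t)|
          + ∫ t, (u m t - l m t) * widthIndicator a (fun i t => u i t - l i t) m t ∂P) := by
  set b := widthIndicator a (fun i t => u i t - l i t) with hb
  have hbm : ∀ k, Measurable (b k) :=
    fun k => measurable_widthIndicator (fun i => (hu i).sub (hl i)) k
  have hb1 : ∀ k t, |b k t| ≤ 1 := fun k t => by
    rcases widthIndicator_eq_zero_or_one a (fun i t => u i t - l i t) k t with h | h <;>
    simp [hb, h]
  have hb0 : ∀ k t, 0 ≤ b k t := fun k t => by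
    rcases widthIndicator_eq_zero_or_one a (fun i t => u i t - l i t) k t with h | h <;>
    simp [hb, h]
  have hbs : ∀ k t, b (k + 1) t ≤ b k t := fun k t => by
    rw [hb, widthIndicator_succ]
    split_ifs
    · simp
    · simpa using hb0 k t
  have hint : ∀ {g h c : 𝓧 → ℝ}, Measurable g → Measurable h → Measurable c → (∀ t, |g t| ≤ K) →
      (∀ t, |h t| ≤ K) → (∀ t, |c t| ≤ 2) → Integrable (fun t => (g t - h t) * c t) P := by
    intro g h c hg hh hc hgK hhK hc2
    refine integrable_of_abs_le (b := (K + K) * 2) ((hg.sub hh).mul hc) fun t => ?_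
    have h1 := abs_sub (g t) (h t)
    have h2 := hgK t
    have h3 := hhK t
    rw [abs_mul]
    exact mul_le_mul (by linarith) (hc2 t) (abs_nonneg _)
      (by linarith [abs_nonneg (g t), abs_nonneg (h t)])
  have hbd : ∀ k t, |b k t - b (k + 1) t| ≤ 2 := fun k t => by
    have h1 := abs_sub (b k t) (b (k + 1) t)
    linarith [hb1 k t, hb1 (k + 1) t]
  have hb2 : ∀ k t, |b k t| ≤ 2 := fun k t => (hb1 k t).trans (by norm_num)
  -- First with the remainder `(f - l m) * b m` left as it is, so that the induction on `m` closes;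
  -- it is replaced by the bracket width only at the end.
  have key : |empiricalDeviation P x n (fun t => f t - f₀ t)| ≤
      |empiricalDeviation P x n (fun t => l 0 t - f₀ t)|
      + ∑ k ∈ Finset.range m,
        (|empiricalDeviation P x n (fun t => (u k t - l k t) * (b k t - b (k + 1) t))|
          + ∫ t, (u k t - l k t) * (b k t - b (k + 1) t) ∂P
          + |empiricalDeviation P x n (fun t => (l (k + 1) t - l k t) * b (k + 1) t)|)
      + |empiricalDeviation P x n (fun t => (f t - l m t) * b m t)| := by
    induction m with
    | zero =>
      have e : (fun t => f t - f₀ t) = fun t => (l 0 t - f₀ t) + (f t - l 0 t) * b 0 t := by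
        ext t; rw [hb, widthIndicator_zero]; ring
      have hi : Integrable (fun t => l 0 t - f₀ t) P := by
        simpa using hint (hl 0) hf₀ (c := fun _ => 1) measurable_const (hlK 0) hf₀K
          (fun _ => by norm_num)
      rw [e, empiricalDeviation_add x n hi (hint hf (hl 0) (hbm 0) hfK (hlK 0) (hb2 0))]
      simpa using abs_add_le _ _
    | succ m ih =>
      refine ih.trans ?_
      rw [Finset.sum_range_succ]
      -- The remainder splits into the part stopped at level `m`, dominated by the bracket width,
      -- the link to the next lower bracket, and the remainder at level `m + 1`.
      have e : (fun t => (f t - l m t) * b m t) = fun t => (f t - l m t) * (b m t - b (m + 1) t)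
          + ((l (m + 1) t - l m t) * b (m + 1) t + (f t - l (m + 1) t) * b (m + 1) t) := by
        ext t; ring
      have i1 := hint hf (hl m) ((hbm m).sub (hbm (m + 1))) hfK (hlK m) (hbd m)
      have i1' := hint (hu m) (hl m) ((hbm m).sub (hbm (m + 1))) (huK m) (hlK m) (hbd m)
      have i2 := hint (hl (m + 1)) (hl m) (hbm (m + 1)) (hlK (m + 1)) (hlK m) (hb2 (m + 1))
      have i3 := hint hf (hl (m + 1)) (hbm (m + 1)) hfK (hlK (m + 1)) (hb2 (m + 1))
      have i23 : Integrable (fun t => (l (m + 1) t - l m t) * b (m + 1) t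
          + (f t - l (m + 1) t) * b (m + 1) t) P := i2.add i3
      have e1 := empiricalDeviation_add x n i1 i23
      have e2 := empiricalDeviation_add x n i2 i3
      have e3 := abs_empiricalDeviation_le_of_le x n i1 i1'
        (fun t => mul_nonneg (by linarith [hlf m t]) (by simpa using hbs m t))
        (fun t => mul_le_mul_of_nonneg_right (by linarith [hfu m t]) (by simpa using hbs m t))
      simp only [Pi.sub_apply] at e1 e3
      rw [e, e1, e2]
      set A := empiricalDeviation P x n fun t => (f t - l m t) * (b m t - b (m + 1) t)
      set B := empiricalDeviation P x n fun t => (l (m + 1) t - l m t) * b (m + 1) t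
      set C := empiricalDeviation P x n fun t => (f t - l (m + 1) t) * b (m + 1) t
      have t1 := abs_add_le A (B + C)
      have t2 := abs_add_le B C
      linarith
  have e3 := abs_empiricalDeviation_le_of_le x n
    (hint hf (hl m) (hbm m) hfK (hlK m) (hb2 m)) (hint (hu m) (hl m) (hbm m) (huK m) (hlK m) (hb2 m))
    (fun t => mul_nonneg (by linarith [hlf m t]) (hb0 m t))
    (fun t => mul_le_mul_of_nonneg_right (by linarith [hfu m t]) (hb0 m t))
  linarith

/-- The number of paths through the first `k + 1` levels, in terms of the last level. -/
theorem two_mul_prod_card_le_exp {N : ℕ → ℕ} {e q : ℝ} (he : 1 ≤ e) (hq : 1 < q)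
    (hN : ∀ k, (N k : ℝ) ≤ Real.exp (e * (q ^ 2) ^ k)) (k : ℕ) :
    2 * (∏ i : Fin (k + 1), (N i : ℝ))
      ≤ Real.exp (e * (1 + q ^ 2 / (q ^ 2 - 1)) * (q ^ 2) ^ k) := by
  have hQ : 1 < q ^ 2 := by nlinarith
  have hQ0 : 0 < q ^ 2 - 1 := by linarith
  have hpow : 1 ≤ (q ^ 2) ^ k := one_le_pow₀ hQ.le
  have h1 : ∏ i : Fin (k + 1), (N i : ℝ) ≤ Real.exp (∑ i : Fin (k + 1), e * (q ^ 2) ^ (i : ℕ)) := by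
    rw [Real.exp_sum]
    exact Finset.prod_le_prod (fun i _ => by positivity) fun i _ => hN i
  have h2 : ∑ i : Fin (k + 1), e * (q ^ 2) ^ (i : ℕ) ≤ e * (q ^ 2 / (q ^ 2 - 1) * (q ^ 2) ^ k) := by
    rw [← Finset.mul_sum, Fin.sum_univ_eq_sum_range (fun i => (q ^ 2) ^ i), geom_sum_eq hQ.ne']
    refine mul_le_mul_of_nonneg_left ?_ (by linarith)
    rw [div_mul_eq_mul_div]
    refine div_le_div_of_nonneg_right ?_ hQ0.le
    rw [pow_succ]; linarith
  -- The factor `2`, due to the two signs in the maximal inequality, is absorbed by one extra copy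
  -- of the last level's entropy; this is where `1 ≤ e` enters.
  have h3 : (2 : ℝ) ≤ Real.exp (e * (q ^ 2) ^ k) := by
    have : 1 ≤ e * (q ^ 2) ^ k := one_le_mul_of_one_le_of_one_le he hpow
    linarith [Real.add_one_le_exp (e * (q ^ 2) ^ k)]
  calc 2 * (∏ i : Fin (k + 1), (N i : ℝ))
      ≤ Real.exp (e * (q ^ 2) ^ k) * Real.exp (e * (q ^ 2 / (q ^ 2 - 1) * (q ^ 2) ^ k)) :=
        mul_le_mul h3 (h1.trans (Real.exp_le_exp.mpr h2))
          (Finset.prod_nonneg fun i _ => by positivity) (Real.exp_pos _).le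
    _ = _ := by rw [← Real.exp_add]; ring_nf

end Chaining

/-! ### The maximal inequality over an `L₂`-ball -/

section BracketingMaximal

variable {𝓧 Ω : Type*} [MeasurableSpace 𝓧] [MeasurableSpace Ω] {P : Measure 𝓧} {μ : Measure Ω}

/-- A maximal inequality for the empirical process over an `L₂`-ball of radius `R`, given brackets
of widths `R / 2 ^ k` whose logarithmic number grows like `q ^ (2 * k)` with `q < 2`. -/
theorem exists_integrable_bound_of_brackets [IsProbabilityMeasure P] [IsProbabilityMeasure μ]
    {X : ℕ → Ω → 𝓧} (hX : ∀ i, HasLaw (X i) P μ) (hind : iIndepFun X μ) {n : ℕ} (hn : 1 ≤ n)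
    {F : Set (𝓧 → ℝ)} {f₀ : 𝓧 → ℝ} {K R e q s : ℝ} (hFm : ∀ f ∈ F, Measurable f)
    (hFK : ∀ f ∈ F, ∀ t, |f t| ≤ K) (hf₀ : Measurable f₀) (hf₀K : ∀ t, |f₀ t| ≤ K)
    (hFR : ∀ f ∈ F, ∫ t, (f t - f₀ t) ^ 2 ∂P ≤ R ^ 2) (hR : 0 < R) (he : 1 ≤ e) (hq : 1 < q)
    (hq2 : q < 2) (hs : 0 < s)
    (hbr : ∀ k : ℕ, ∃ N : ℕ, HasBracketing F 2 P (R / 2 ^ k) N ∧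
      (N : ℝ) ≤ Real.exp (e * (q ^ 2) ^ k))
    (hsn : s ^ 2 * (e * (1 + q ^ 2 / (q ^ 2 - 1))) ≤ n) (hsK : 2 * K ≤ R * s) :
    ∃ W : Ω → ℝ, Integrable W μ ∧
      (∀ f ∈ F, ∀ ω, |empiricalDeviation P (fun i => X i ω) n (fun t => f t - f₀ t)| ≤ W ω) ∧
      ∫ ω, W ω ∂μ ≤ 45 / (1 - q / 2) * (R / s) := by
  classical
  rcases isEmpty_or_nonempty 𝓧 with hempty | ⟨⟨t₀⟩⟩
  · have := measure_univ (μ := P)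
    rw [Set.univ_eq_empty_iff.mpr hempty, measure_empty] at this
    exact absurd this zero_ne_one
  have hK : 0 ≤ K := (abs_nonneg _).trans (hf₀K t₀)
  have hn0 : (0 : ℝ) < n := by positivity
  have hq0 : 0 < q := by linarith
  have hQ0 : 0 < q ^ 2 - 1 := by nlinarith
  choose N hNbr hN using hbr
  choose l u hl hu hlK huK hw hc using
    fun k => (hNbr k).exists_bounded hK (by positivity) hFK
  choose j hj using fun (k : ℕ) (f : F) => hc k f.1 f.2
  set E := e * (1 + q ^ 2 / (q ^ 2 - 1)) with hE
  have hE0 : 0 < E := by positivity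
  -- With `τ = 1 / (2 a k)` this threshold balances the two terms of the finite maximal inequality:
  -- the entropy term and the variance term are both of order `(R / s) * (q / 2) ^ k`.
  set a : ℕ → ℝ := fun k => R * s / (2 * q) ^ k with ha
  have ha0 : ∀ k, 0 < a k := fun k => by simp only [ha]; positivity
  have hamono : ∀ k, a (k + 1) ≤ a k := fun k => by
    simp only [ha]
    exact div_le_div_of_nonneg_left (by positivity) (by positivity)
      (pow_le_pow_right₀ (by linarith) (Nat.le_succ k))
  let lo : F → ℕ → 𝓧 → ℝ := fun f k => l k (j k f)
  let up : F → ℕ → 𝓧 → ℝ := fun f k => u k (j k f)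
  let wd : F → ℕ → 𝓧 → ℝ := fun f k t => up f k t - lo f k t
  have hwdm : ∀ f k, Measurable (wd f k) := fun f k => (hu k _).sub (hl k _)
  have hwd0 : ∀ f k t, 0 ≤ wd f k t := fun f k t => by
    have := hj k f t
    simp only [wd, up, lo]; linarith
  have hwdK : ∀ f k t, |wd f k t| ≤ 2 * K := fun f k t => by
    have h1 := abs_sub (up f k t) (lo f k t)
    have h2 := huK k (j k f) t
    have h3 := hlK k (j k f) t
    simp only [wd, up, lo] at *
    linarith
  -- By `hsK` nothing is truncated at level zero.
  have hwda : ∀ f t, wd f 0 t ≤ a 0 := fun f t => by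
    have := (le_abs_self _).trans (hwdK f 0 t)
    simp only [ha, pow_zero, div_one]
    linarith
  have hwdsq : ∀ f k, ∫ t, wd f k t ^ 2 ∂P ≤ (R / 2 ^ k) ^ 2 := fun f k => hw k (j k f)
  have hwdsqi : ∀ f k, Integrable (fun t => wd f k t ^ 2) P := fun f k =>
    integrable_of_abs_le (b := (2 * K) ^ 2) ((hwdm f k).pow_const 2) fun t => by
      rw [abs_pow]; exact pow_le_pow_left₀ (abs_nonneg _) (hwdK f k t) 2
  have hδ : ∀ k : ℕ, (R / 2 ^ (k + 1)) ^ 2 ≤ (R / 2 ^ k) ^ 2 := fun k =>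
    pow_le_pow_left₀ (by positivity) (div_le_div_of_nonneg_left hR.le (by positivity)
      (pow_le_pow_right₀ (by norm_num) (Nat.le_succ k))) 2
  let b : F → ℕ → 𝓧 → ℝ := fun f k => widthIndicator a (wd f) k
  have hbm : ∀ f k, Measurable (b f k) := fun f k => measurable_widthIndicator (hwdm f) k
  set ρ := q / 2 with hρ
  have hρ1 : ρ < 1 := by rw [hρ]; linarith
  have hρ0 : 0 < ρ := by positivity
  -- The functions at step `k` may involve the brackets of levels `0, …, k + 1`, hence the path
  -- space with `k + 2` factors. The constant is `10 ≥ 2 q² + 2`.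
  have level : ∀ (k : ℕ) (h : F → 𝓧 → ℝ),
      (∀ f f' : F, (∀ i ≤ k + 1, j i f = j i f') → h f = h f') → (∀ f, Measurable (h f)) →
      (∀ f t, |h f t| ≤ a k) → (∀ f, ∫ t, h f t ^ 2 ∂P ≤ 4 * (R / 2 ^ k) ^ 2) →
      ∃ W : Ω → ℝ, Integrable W μ ∧
        (∀ f ω, |empiricalDeviation P (fun i => X i ω) n (h f)| ≤ W ω) ∧
        ∫ ω, W ω ∂μ ≤ 10 * (R / s) * ρ ^ k := by
    intro k h hdep hhm hhb hhv
    obtain ⟨W, hW1, hW2, hW3⟩ := exists_integrable_bound_of_finite hX hind hn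
      (T := ∀ i : Fin (k + 1 + 1), Fin (N i)) (fun f i => j i f) h
      (fun f f' hff => hdep f f' fun i hi => congrFun hff ⟨i, by omega⟩)
      (ℓ := E * (q ^ 2) ^ (k + 1)) (b := a k) (v := 4 * (R / 2 ^ k) ^ 2) (τ := (2 * a k)⁻¹)
      (by
        have := two_mul_prod_card_le_exp he hq hN (k + 1)
        simpa [Fintype.card_pi] using this)
      hhm hhb hhv (by have := ha0 k; positivity)
      (by have := ha0 k; rw [inv_mul_cancel₀ (by positivity)])
    refine ⟨W, hW1, hW2, hW3.trans ?_⟩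
    have hak := ha0 k
    have e1 : E * (q ^ 2) ^ (k + 1) / (n * (2 * a k)⁻¹)
        ≤ E * (q ^ 2) ^ (k + 1) / (s ^ 2 * E * (2 * a k)⁻¹) :=
      div_le_div_of_nonneg_left (by positivity) (by positivity)
        (mul_le_mul_of_nonneg_right hsn (by positivity))
    have e2 : E * (q ^ 2) ^ (k + 1) / (s ^ 2 * E * (2 * a k)⁻¹)
        = 2 * q ^ 2 * ((R / s) * ρ ^ k) := by
      simp only [ha, hρ, mul_pow, div_pow]
      field_simp
      ring
    have e3 : (2 * a k)⁻¹ * (4 * (R / 2 ^ k) ^ 2) = 2 * ((R / s) * ρ ^ k) := by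
      simp only [ha, hρ, mul_pow, div_pow]
      field_simp
      ring
    rw [e2] at e1
    rw [e3]
    have e4 : 0 ≤ (R / s) * ρ ^ k := by positivity
    have e5 : q ^ 2 ≤ 4 := by nlinarith
    nlinarith
  have hjb : ∀ (f f' : F) (k : ℕ), (∀ i ≤ k, j i f = j i f') → b f k = b f' k := by
    intro f f' k h
    refine widthIndicator_congr a fun i hi => ?_
    simp only [wd, up, lo, h i hi]
  -- The start of the chain; only here does the ball radius enter, through `(l₀ - f₀)² ≤ 2 w₀² + 2
  -- (f - f₀)²`, whose integral is at most `4 R²`.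
  obtain ⟨W₀, hW₀i, hW₀, hW₀e⟩ := level 0 (fun f t => lo f 0 t - f₀ t)
    (fun f f' h => by simp only [lo, h 0 (by omega)]) (fun f => (hl 0 _).sub hf₀)
    (fun f t => by
      have h1 := abs_sub (lo f 0 t) (f₀ t)
      have h2 := hlK 0 (j 0 f) t
      have h3 := hf₀K t
      simp only [ha, pow_zero, div_one]
      simp only [lo] at *
      linarith)
    (fun f => by
      have hfi : Integrable (fun t => (f.1 t - f₀ t) ^ 2) P :=
        integrable_of_abs_le (b := (2 * K) ^ 2) (((hFm f.1 f.2).sub hf₀).pow_const 2) fun t => by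
          rw [abs_pow]
          refine pow_le_pow_left₀ (abs_nonneg _) ?_ 2
          have h1 := abs_sub (f.1 t) (f₀ t)
          linarith [hFK f.1 f.2 t, hf₀K t]
      have h1 : ∫ t, (lo f 0 t - f₀ t) ^ 2 ∂P
          ≤ ∫ t, (2 * wd f 0 t ^ 2 + 2 * (f.1 t - f₀ t) ^ 2) ∂P := by
        refine integral_mono_of_nonneg (Eventually.of_forall fun t => sq_nonneg _)
          (((hwdsqi f 0).const_mul 2).add (hfi.const_mul 2)) (Eventually.of_forall fun t => ?_)
        have h2 := hj 0 f t
        have h3 : (lo f 0 t - f.1 t) ^ 2 ≤ wd f 0 t ^ 2 := by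
          simp only [wd, up, lo]
          nlinarith
        have h4 := sq_nonneg ((lo f 0 t - f.1 t) - (f.1 t - f₀ t))
        beta_reduce
        nlinarith
      rw [integral_add ((hwdsqi f 0).const_mul 2) (hfi.const_mul 2), integral_const_mul,
        integral_const_mul] at h1
      have h5 := hwdsq f 0
      have h6 := hFR f.1 f.2
      simp only [pow_zero, div_one] at *
      linarith)
  have htrunc := fun k => level k (fun f t => wd f k t * (b f k t - b f (k + 1) t))
    (fun f f' h => by
      simp only [hjb f f' k fun i hi => h i (by omega), hjb f f' (k + 1) h]
      simp only [wd, up, lo, h k (by omega)])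
    (fun f => (hwdm f k).mul ((hbm f k).sub (hbm f (k + 1))))
    (fun f t => by
      obtain ⟨h1, h2, -, -⟩ := width_term_bounds (k := k) ha0 (fun i => hwd0 f i t) (hwda f t)
      exact abs_le.mpr ⟨by linarith [ha0 k], h2⟩)
    (fun f => by
      refine (integral_mono_of_nonneg (Eventually.of_forall fun t => sq_nonneg _) (hwdsqi f k)
        (Eventually.of_forall fun t => ?_)).trans ((hwdsq f k).trans (by
          linarith [sq_nonneg (R / 2 ^ k)]))
      obtain ⟨h1, -, h3, -⟩ := width_term_bounds (k := k) ha0 (fun i => hwd0 f i t) (hwda f t)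
      exact pow_le_pow_left₀ h1 h3 2)
  choose Ws hWsi hWs hWse using htrunc
  have hlink := fun k => level k (fun f t => (lo f (k + 1) t - lo f k t) * b f (k + 1) t)
    (fun f f' h => by
      simp only [hjb f f' (k + 1) h]
      simp only [lo, h k (by omega), h (k + 1) le_rfl])
    (fun f => ((hl _ _).sub (hl _ _)).mul (hbm f (k + 1)))
    (fun f t => (link_term_bounds (k := k) (l := lo f) (u := up f) (f := f.1) ha0 (hamono k)
      (fun i => (hj i f t).1) (fun i => (hj i f t).2) (hwda f t)).1)
    (fun f => by
      refine (integral_mono_of_nonneg (Eventually.of_forall fun t => sq_nonneg _)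
        ((hwdsqi f k).add (hwdsqi f (k + 1))) (Eventually.of_forall fun t =>
          (link_term_bounds (k := k) (l := lo f) (u := up f) (f := f.1) ha0 (hamono k)
            (fun i => (hj i f t).1) (fun i => (hj i f t).2) (hwda f t)).2)).trans ?_
      have := integral_add (hwdsqi f k) (hwdsqi f (k + 1))
      simp only [Pi.add_apply]
      rw [this]
      linarith [hwdsq f k, hwdsq f (k + 1), hδ k, sq_nonneg (R / 2 ^ k)])
  choose Wl hWli hWl hWle using hlink
  -- At this depth the last brackets have mean width at most `R / 2 ^ m ≤ R / s`, so the chain may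
  -- end.
  obtain ⟨m, hm⟩ : ∃ m : ℕ, s ≤ 2 ^ m := by
    obtain ⟨m, hm⟩ := pow_unbounded_of_one_lt s (one_lt_two)
    exact ⟨m, hm.le⟩
  have hend_le : ∀ (f : F) t, 0 ≤ wd f m t * b f m t ∧ wd f m t * b f m t ≤ wd f m t ∧
      wd f m t * b f m t ≤ a m := by
    intro f t
    rcases widthIndicator_eq_zero_or_one a (wd f) m t with h | h
    · simp only [b, h, mul_zero]; exact ⟨le_rfl, hwd0 f m t, (ha0 m).le⟩
    · simp only [b, h, mul_one]
      exact ⟨hwd0 f m t, le_rfl, le_of_widthIndicator_eq_one (hwda f t) h⟩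
  obtain ⟨We, hWei, hWe, hWee⟩ := level m (fun f t => wd f m t * b f m t)
    (fun f f' h => by
      simp only [hjb f f' m fun i hi => h i (by omega)]
      simp only [wd, up, lo, h m (by omega)])
    (fun f => (hwdm f m).mul (hbm f m))
    (fun f t => abs_le.mpr ⟨by linarith [ha0 m, (hend_le f t).1], (hend_le f t).2.2⟩)
    (fun f => by
      refine (integral_mono_of_nonneg (Eventually.of_forall fun t => sq_nonneg _) (hwdsqi f m)
        (Eventually.of_forall fun t => pow_le_pow_left₀ (hend_le f t).1 (hend_le f t).2.1 2)).trans
        ((hwdsq f m).trans (by linarith [sq_nonneg (R / 2 ^ m)])))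
  have htrunc_int : ∀ (f : F) k, ∫ t, wd f k t * (b f k t - b f (k + 1) t) ∂P
      ≤ 4 * (R / s) * ρ ^ k := by
    intro f k
    have h1 : ∫ t, wd f k t * (b f k t - b f (k + 1) t) ∂P
        ≤ ∫ t, (wd f k t ^ 2 + wd f (k + 1) t ^ 2) / (2 * a (k + 1)) ∂P :=
      integral_mono_of_nonneg
        (Eventually.of_forall fun t =>
          (width_term_bounds (k := k) ha0 (fun i => hwd0 f i t) (hwda f t)).1)
        (((hwdsqi f k).add (hwdsqi f (k + 1))).div_const _)
        (Eventually.of_forall fun t =>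
          (width_term_bounds (k := k) ha0 (fun i => hwd0 f i t) (hwda f t)).2.2.2)
    rw [integral_div, integral_add (hwdsqi f k) (hwdsqi f (k + 1))] at h1
    have h2 : ∫ t, wd f k t ^ 2 ∂P + ∫ t, wd f (k + 1) t ^ 2 ∂P ≤ 2 * (R / 2 ^ k) ^ 2 := by
      linarith [hwdsq f k, hwdsq f (k + 1), hδ k]
    have h3 : 2 * (R / 2 ^ k) ^ 2 / (2 * a (k + 1)) = 2 * q * ((R / s) * ρ ^ k) := by
      simp only [ha, hρ, mul_pow, div_pow, pow_succ]
      field_simp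
    have h4 := div_le_div_of_nonneg_right h2 (c := 2 * a (k + 1)) (by linarith [ha0 (k + 1)])
    rw [h3] at h4
    have h5 : 0 ≤ (R / s) * ρ ^ k := by positivity
    nlinarith
  have hend_int : ∀ f : F, ∫ t, wd f m t * b f m t ∂P ≤ R / s := by
    intro f
    set δ := R / 2 ^ m with hδd
    have hδ0 : 0 < δ := by positivity
    -- `w ≤ (w² + δ²) / (2δ)` stands in for the Cauchy–Schwarz inequality.
    have h1 : ∫ t, wd f m t * b f m t ∂P ≤ ∫ t, (wd f m t ^ 2 + δ ^ 2) / (2 * δ) ∂P := by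
      refine integral_mono_of_nonneg (Eventually.of_forall fun t => (hend_le f t).1)
        (((hwdsqi f m).add (integrable_const _)).div_const _) (Eventually.of_forall fun t => ?_)
      refine (hend_le f t).2.1.trans ?_
      rw [le_div_iff₀ (by positivity)]
      nlinarith [sq_nonneg (wd f m t - δ)]
    rw [integral_div, integral_add (hwdsqi f m) (integrable_const _)] at h1
    simp only [integral_const, probReal_univ, smul_eq_mul, one_mul] at h1
    have h2 : (∫ t, wd f m t ^ 2 ∂P + δ ^ 2) / (2 * δ) ≤ δ := by
      rw [div_le_iff₀ (by positivity)]
      linarith [hwdsq f m]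
    have h3 : δ ≤ R / s := div_le_div_of_nonneg_left hR.le hs hm
    linarith
  have hsum_int : Integrable (fun ω => ∑ k ∈ Finset.range m,
      (Ws k ω + 4 * (R / s) * ρ ^ k + Wl k ω)) μ :=
    integrable_finsetSum _ fun k _ => ((hWsi k).add (integrable_const _)).add (hWli k)
  -- The constant: `10` for the start, `10 + 4 + 10` for each level, `10 + 1` for the end, in total
  -- at most `45 / (1 - ρ)`.
  refine ⟨fun ω => W₀ ω + ∑ k ∈ Finset.range m, (Ws k ω + 4 * (R / s) * ρ ^ k + Wl k ω)
    + (We ω + R / s), (hW₀i.add hsum_int).add (hWei.add (integrable_const _)), ?_, ?_⟩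
  · intro f hf ω
    have hch := abs_empiricalDeviation_chain_le (P := P) (fun i => X i ω) n (hFm f hf) hf₀ (hFK f hf)
      hf₀K (l := lo ⟨f, hf⟩) (u := up ⟨f, hf⟩) (fun i => hl _ _) (fun i => hu _ _)
      (fun i => hlK _ _) (fun i => huK _ _) (fun i t => (hj i ⟨f, hf⟩ t).1)
      (fun i t => (hj i ⟨f, hf⟩ t).2) a m
    refine hch.trans (add_le_add (add_le_add (hW₀ ⟨f, hf⟩ ω) (Finset.sum_le_sum fun k _ => ?_))
      (add_le_add (hWe ⟨f, hf⟩ ω) (hend_int ⟨f, hf⟩)))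
    exact add_le_add (add_le_add (hWs k ⟨f, hf⟩ ω) (htrunc_int ⟨f, hf⟩ k)) (hWl k ⟨f, hf⟩ ω)
  · have h1 : ∫ ω, (W₀ ω + ∑ k ∈ Finset.range m, (Ws k ω + 4 * (R / s) * ρ ^ k + Wl k ω)
        + (We ω + R / s)) ∂μ = ∫ ω, W₀ ω ∂μ + ∑ k ∈ Finset.range m,
          (∫ ω, Ws k ω ∂μ + 4 * (R / s) * ρ ^ k + ∫ ω, Wl k ω ∂μ) + (∫ ω, We ω ∂μ + R / s) := by
      have i1 : Integrable (fun ω => We ω + R / s) μ := hWei.add (integrable_const _)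
      have i2 : Integrable (fun ω => W₀ ω + ∑ k ∈ Finset.range m,
        (Ws k ω + 4 * (R / s) * ρ ^ k + Wl k ω)) μ := hW₀i.add hsum_int
      have i3 : ∀ k, Integrable (fun ω => Ws k ω + 4 * (R / s) * ρ ^ k) μ :=
        fun k => (hWsi k).add (integrable_const _)
      have i4 : ∀ k, Integrable (fun ω => Ws k ω + 4 * (R / s) * ρ ^ k + Wl k ω) μ :=
        fun k => (i3 k).add (hWli k)
      rw [integral_add i2 i1, integral_add hW₀i hsum_int, integral_add hWei (integrable_const _),
        integral_finsetSum _ fun k _ => i4 k]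
      congr 2
      · refine congrArg _ (funext fun k => ?_)
        rw [integral_add (i3 k) (hWli k), integral_add (hWsi k) (integrable_const _)]
        simp
      · simp
    have h2 : ∑ k ∈ Finset.range m, (∫ ω, Ws k ω ∂μ + 4 * (R / s) * ρ ^ k + ∫ ω, Wl k ω ∂μ)
        ≤ 24 * (R / s) * (1 - ρ)⁻¹ := by
      calc _ ≤ ∑ k ∈ Finset.range m, 24 * (R / s) * ρ ^ k :=
            Finset.sum_le_sum fun k _ => by linarith [hWse k, hWle k]
        _ = 24 * (R / s) * ∑ k ∈ Finset.range m, ρ ^ k := (Finset.mul_sum _ _ _).symm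
        _ ≤ 24 * (R / s) * (1 - ρ)⁻¹ := by
            refine mul_le_mul_of_nonneg_left ?_ (by positivity)
            rw [← tsum_geometric_of_lt_one hρ0.le hρ1]
            exact (summable_geometric_of_lt_one hρ0.le hρ1).sum_le_tsum _
              fun k _ => by positivity
    rw [h1]
    have h3 : (1 : ℝ) ≤ (1 - ρ)⁻¹ := (one_le_inv₀ (by linarith)).mpr (by linarith)
    have h4 : ρ ^ m ≤ 1 := pow_le_one₀ hρ0.le hρ1.le
    have h5 : 0 < R / s := by positivity
    rw [pow_zero] at hW₀e
    rw [div_eq_mul_inv 45]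
    have h6 : (R / s) * ρ ^ m ≤ R / s := by nlinarith
    have h7 : R / s ≤ (R / s) * (1 - ρ)⁻¹ := by nlinarith
    nlinarith

end BracketingMaximal

/-! ### From bracketing entropy to the modulus of continuity -/

section Entropy

variable {𝓧 Ω : Type*} [MeasurableSpace 𝓧] [MeasurableSpace Ω] {P Q : Measure 𝓧} {μ : Measure Ω}

/-- A real entropy bound excludes the value `⊤`, and the infimum of a nonempty subset of `ℕ∞` is
attained. -/
theorem exists_hasBracketing_of_bracketingEntropy_le {G : Set (𝓧 → ℝ)} {r : ℝ≥0∞} {δ h : ℝ}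
    (hh : bracketingEntropy G r Q δ ≤ (h : EReal)) :
    ∃ N : ℕ, HasBracketing G r Q δ N ∧ (N : ℝ) ≤ Real.exp h := by
  unfold bracketingEntropy at hh
  rcases Set.eq_empty_or_nonempty {m : ℕ∞ | ∃ N : ℕ, m = N ∧ HasBracketing G r Q δ N} with he | hne
  · rw [bracketingNumber, he, sInf_empty] at hh
    simp at hh
  · obtain ⟨N, hN, hb⟩ := csInf_mem hne
    refine ⟨N, hb, ?_⟩
    rw [bracketingNumber, hN] at hh
    replace hh := EReal.exp_monotone hh
    rw [ENNReal.exp_log, EReal.exp_coe] at hh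
    have h2 : ENNReal.ofReal (N : ℝ) ≤ ENNReal.ofReal (Real.exp h) := by simpa using hh
    exact (ENNReal.ofReal_le_ofReal_iff (Real.exp_pos h).le).mp h2

/-- `√K` would suffice; `2 * K` is the factor in `HasBracketing.sq`, so both classes get the same
rescaled entropy bound. -/
theorem HasBracketing.of_le_smul {G : Set (𝓧 → ℝ)} {δ K : ℝ} {N : ℕ} (hK : 1 ≤ K)
    (hPQ : P ≤ ENNReal.ofReal K • Q) (h : HasBracketing G 2 Q δ N) :
    HasBracketing G 2 P (2 * K * δ) N := by
  obtain ⟨gL, gU, hm, hw, hc⟩ := h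
  refine ⟨gL, gU, hm, fun j => ?_, hc⟩
  have hK0 : 0 ≤ K := by linarith
  calc eLpNorm (gU j - gL j) 2 P ≤ eLpNorm (gU j - gL j) 2 (ENNReal.ofReal K • Q) :=
        eLpNorm_mono_measure _ hPQ
    _ = ENNReal.ofReal K ^ (1 / (2 : ℝ≥0∞)).toReal • eLpNorm (gU j - gL j) 2 Q :=
        eLpNorm_smul_measure_of_ne_top (by norm_num) _ _
    _ ≤ ENNReal.ofReal (2 * K) * ENNReal.ofReal δ := by
        rw [smul_eq_mul]
        refine mul_le_mul' ?_ (hw j)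
        rw [ENNReal.ofReal_rpow_of_nonneg hK0 (by positivity)]
        refine ENNReal.ofReal_le_ofReal ?_
        calc K ^ (1 / (2 : ℝ≥0∞)).toReal ≤ K ^ (1 : ℝ) :=
              Real.rpow_le_rpow_of_exponent_le hK (by norm_num)
          _ ≤ 2 * K := by rw [Real.rpow_one]; linarith
    _ = ENNReal.ofReal (2 * K * δ) := (ENNReal.ofReal_mul (by positivity)).symm

/-- Squaring a class of nonnegative functions bounded by `K` scales brackets by at most `2 K`. -/
theorem HasBracketing.sq [IsFiniteMeasure Q] {G : Set (𝓧 → ℝ)} {δ K : ℝ} {N : ℕ} (hK : 0 ≤ K)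
    (hδ : 0 ≤ δ)
    (hG0 : ∀ g ∈ G, ∀ x, 0 ≤ g x) (hGK : ∀ g ∈ G, ∀ x, |g x| ≤ K) (h : HasBracketing G 2 Q δ N) :
    HasBracketing ((fun g x => g x ^ 2) '' G) 2 Q (2 * K * δ) N := by
  obtain ⟨l, u, hl, hu, hlK, huK, hw, hc⟩ := h.exists_bounded hK hδ hGK
  -- Squaring is monotone only on `[0, ∞)`, hence the positive parts; on `[0, K]` it is
  -- `2K`-Lipschitz.
  have hlm : ∀ j, Measurable fun x => max (l j x) 0 ^ 2 :=
    fun j => ((hl j).max measurable_const).pow_const 2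
  have hum : ∀ j, Measurable fun x => max (u j x) 0 ^ 2 :=
    fun j => ((hu j).max measurable_const).pow_const 2
  have hdiff : ∀ j x, (max (u j x) 0 ^ 2 - max (l j x) 0 ^ 2) ^ 2
      ≤ (2 * K) ^ 2 * (u j x - l j x) ^ 2 := by
    intro j x
    have h1 := abs_max_sub_max_le_abs (u j x) (l j x) 0
    have h2 : |max (u j x) 0 + max (l j x) 0| ≤ 2 * K := by
      rw [abs_of_nonneg (add_nonneg (le_max_right _ _) (le_max_right _ _))]
      have h3 : max (u j x) 0 ≤ K := max_le (abs_le.mp (huK j x)).2 hK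
      have h4 : max (l j x) 0 ≤ K := max_le (abs_le.mp (hlK j x)).2 hK
      linarith
    have h5 := mul_le_mul h2 h1 (abs_nonneg _) (by positivity)
    rw [← abs_mul] at h5
    calc (max (u j x) 0 ^ 2 - max (l j x) 0 ^ 2) ^ 2
        = |(max (u j x) 0 + max (l j x) 0) * (max (u j x) 0 - max (l j x) 0)| ^ 2 := by
          rw [sq_abs]; ring
      _ ≤ (2 * K * |u j x - l j x|) ^ 2 := pow_le_pow_left₀ (abs_nonneg _) h5 2
      _ = _ := by rw [mul_pow, sq_abs]
  have hwi : ∀ j, Integrable (fun x => (u j x - l j x) ^ 2) Q := fun j =>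
    Integrable.of_bound (((hu j).sub (hl j)).pow_const 2).aestronglyMeasurable ((2 * K) ^ 2)
      (Eventually.of_forall fun x => by
        rw [Real.norm_eq_abs, abs_pow]
        refine pow_le_pow_left₀ (abs_nonneg _) ?_ 2
        have := abs_sub (u j x) (l j x)
        linarith [hlK j x, huK j x])
  refine ⟨fun j x => max (l j x) 0 ^ 2, fun j x => max (u j x) 0 ^ 2,
    fun j => ⟨hlm j, hum j⟩, fun j => ?_, ?_⟩
  · have hle : ∀ x, ‖(max (u j x) 0 ^ 2 - max (l j x) 0 ^ 2) ^ 2‖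
        ≤ (2 * K) ^ 2 * (u j x - l j x) ^ 2 := fun x => by
      rw [Real.norm_eq_abs, abs_of_nonneg (sq_nonneg _)]; exact hdiff j x
    have hm : Measurable fun x => (max (u j x) 0 ^ 2 - max (l j x) 0 ^ 2) ^ 2 :=
      ((hum j).sub (hlm j)).pow_const 2
    have hi : Integrable (fun x => (max (u j x) 0 ^ 2 - max (l j x) 0 ^ 2) ^ 2) Q :=
      Integrable.mono' (g := fun x => (2 * K) ^ 2 * (u j x - l j x) ^ 2) ((hwi j).const_mul _)
        hm.aestronglyMeasurable (Eventually.of_forall hle)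
    have hle2 : ∫ x, (max (u j x) 0 ^ 2 - max (l j x) 0 ^ 2) ^ 2 ∂Q ≤ (2 * K * δ) ^ 2 := by
      refine (integral_mono hi ((hwi j).const_mul _) (hdiff j)).trans ?_
      rw [integral_const_mul, mul_pow (2 * K) δ]
      exact mul_le_mul_of_nonneg_left (hw j) (by positivity)
    have h2 : 0 ≤ 2 * K * δ := by positivity
    set w : 𝓧 → ℝ := fun x => max (u j x) 0 ^ 2 - max (l j x) 0 ^ 2 with hwdef
    have hle3 : eLpNorm w 2 Q ≤ ENNReal.ofReal (2 * K * δ) :=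
      eLpNorm_le_ofReal_of_integral_sq_le h2 hi hle2
    exact hle3
  · rintro _ ⟨g, hg, rfl⟩
    obtain ⟨j, hj⟩ := hc g hg
    refine ⟨j, fun x => ⟨?_, ?_⟩⟩
    · exact pow_le_pow_left₀ (le_max_right _ _) (max_le (hj x).1 (hG0 g hg x)) 2
    · exact pow_le_pow_left₀ (hG0 g hg x) ((hj x).2.trans (le_max_left _ _)) 2

theorem HasBracketing.mono_class {F F' : Set (𝓧 → ℝ)} {r : ℝ≥0∞} {δ : ℝ} {N : ℕ} (hF : F' ⊆ F)
    (h : HasBracketing F r P δ N) : HasBracketing F' r P δ N := by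
  obtain ⟨gL, gU, hm, hw, hc⟩ := h
  exact ⟨gL, gU, hm, hw, fun g hg => hc g (hF hg)⟩

/-- The modulus of continuity of the empirical process indexed by a uniformly bounded class whose
entropy with bracketing is of order `δ ^ (-γ)`, `γ < 2`. -/
theorem exists_modulus_of_entropy [IsProbabilityMeasure P] [IsProbabilityMeasure μ]
    {X : ℕ → Ω → 𝓧} (hX : ∀ i, HasLaw (X i) P μ) (hind : iIndepFun X μ)
    {F : Set (𝓧 → ℝ)} {f₀ : 𝓧 → ℝ} (hf₀ : f₀ ∈ F) {K A γ M : ℝ} (hFm : ∀ f ∈ F, Measurable f)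
    (hFK : ∀ f ∈ F, ∀ t, |f t| ≤ K) (hM : 0 < M) (hK : 0 ≤ K) (hγ0 : 0 < γ) (hγ2 : γ < 2)
    (hent : ∀ δ : ℝ, 0 < δ →
      ∃ N : ℕ, HasBracketing F 2 P δ N ∧ (N : ℝ) ≤ Real.exp (A * δ ^ (-γ))) :
    ∃ C B : ℝ, 0 < C ∧ ∀ n : ℕ, 1 ≤ n → ∀ R : ℝ, 0 < R → R ≤ M → B ≤ R ^ (2 + γ) * n →
      ∃ W : Ω → ℝ, Integrable W μ ∧
        (∀ f ∈ F, ∫ t, (f t - f₀ t) ^ 2 ∂P ≤ R ^ 2 →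
          ∀ ω, |empiricalDeviation P (fun i => X i ω) n (fun t => f t - f₀ t)| ≤ W ω) ∧
        ∫ ω, W ω ∂μ ≤ C * (R ^ (1 - γ / 2) * (n : ℝ) ^ (-(1 / 2) : ℝ)) := by
  -- Enlarging `A` makes the entropy `A' * R ^ (-γ)` at least `1` for every `R ≤ M`.
  set A' := max A (M ^ γ) with hA'
  have hA'0 : 0 < A' := lt_of_lt_of_le (by positivity) (le_max_right _ _)
  -- Halving the width multiplies the entropy bound by `2 ^ γ = q ^ 2`; the chaining series
  -- converges since `γ < 2` means `q < 2`.
  set q : ℝ := 2 ^ (γ / 2) with hq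
  have hq1 : 1 < q := Real.one_lt_rpow (by norm_num) (by linarith)
  have hq2 : q < 2 := by
    calc q < 2 ^ (1 : ℝ) := Real.rpow_lt_rpow_of_exponent_lt (by norm_num) (by linarith)
      _ = 2 := Real.rpow_one 2
  have hQ0 : 0 < q ^ 2 - 1 := by nlinarith
  have hqq : q ^ 2 = 2 ^ γ := by
    rw [hq, ← Real.rpow_natCast, ← Real.rpow_mul (by norm_num)]; norm_num
  set c := 1 + q ^ 2 / (q ^ 2 - 1) with hc
  have hc0 : 0 < c := by positivity
  set D := A' * c with hD
  have hD0 : 0 < D := by positivity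
  have hρ : 0 < 1 - q / 2 := by linarith
  refine ⟨45 / (1 - q / 2) * D ^ (1 / 2 : ℝ), (2 * K) ^ 2 * D, by positivity, ?_⟩
  intro n hn R hR hRM hB
  have hn0 : (0 : ℝ) < n := by positivity
  set e := A' * R ^ (-γ) with he
  have he1 : 1 ≤ e := by
    calc (1 : ℝ) = R ^ γ * R ^ (-γ) := by rw [← Real.rpow_add hR]; simp
      _ ≤ A' * R ^ (-γ) := by
        refine mul_le_mul_of_nonneg_right ?_ (by positivity)
        exact (Real.rpow_le_rpow hR.le hRM hγ0.le).trans (le_max_right _ _)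
  -- The largest `s` that the sample size allows (equality in `hsn`). Then `R / s` is the claimed
  -- modulus up to a constant, and `2 K ≤ R s` becomes `(2K)² D ≤ R^(2+γ) n`.
  set s := ((n : ℝ) / (D * R ^ (-γ))) ^ (1 / 2 : ℝ) with hs
  have hs0 : 0 < s := by positivity
  have hs2 : s ^ 2 = (n : ℝ) / (D * R ^ (-γ)) := by
    rw [hs, ← Real.rpow_natCast, ← Real.rpow_mul (by positivity)]; norm_num
  obtain ⟨W, hWi, hW, hWe⟩ := exists_integrable_bound_of_brackets hX hind hn
    (F := {f ∈ F | ∫ t, (f t - f₀ t) ^ 2 ∂P ≤ R ^ 2}) (f₀ := f₀) (K := K) (R := R) (e := e) (q := q)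
    (s := s) (fun f hf => hFm f hf.1) (fun f hf => hFK f hf.1) (hFm _ hf₀) (hFK _ hf₀)
    (fun f hf => hf.2) hR he1 hq1 hq2 hs0
    (fun k => by
      obtain ⟨N, hN, hNe⟩ := hent (R / 2 ^ k) (by positivity)
      refine ⟨N, hN.mono_class fun f hf => hf.1, hNe.trans (Real.exp_le_exp.mpr ?_)⟩
      have h1 : (R / 2 ^ k) ^ (-γ) = R ^ (-γ) * (q ^ 2) ^ k := by
        rw [hqq, Real.div_rpow hR.le (by positivity), Real.rpow_neg (x := 2 ^ k) (by positivity),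
          div_inv_eq_mul, ← Real.rpow_natCast 2 k, ← Real.rpow_natCast (2 ^ γ) k,
          ← Real.rpow_mul (by norm_num), ← Real.rpow_mul (by norm_num), mul_comm γ]
      rw [h1, he, mul_assoc]
      exact mul_le_mul_of_nonneg_right (le_max_left _ _) (by positivity))
    (by
      rw [← hc, hs2, he, hD]
      refine le_of_eq ?_
      have : 0 < R ^ (-γ) := by positivity
      field_simp)
    (by
      refine (pow_le_pow_iff_left₀ (by positivity) (by positivity) two_ne_zero).mp ?_
      rw [mul_pow R, hs2]
      have h1 : R ^ 2 * ((n : ℝ) / (D * R ^ (-γ))) = R ^ (2 + γ) * n / D := by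
        rw [Real.rpow_add hR, Real.rpow_neg hR.le, Real.rpow_two]
        have : 0 < R ^ γ := by positivity
        field_simp
      rw [h1, le_div_iff₀ hD0]
      exact hB)
  refine ⟨W, hWi, fun f hf hfR ω => hW f ⟨hf, hfR⟩ ω, hWe.trans (le_of_eq ?_)⟩
  have h1 : R / s = D ^ (1 / 2 : ℝ) * (R ^ (1 - γ / 2) * (n : ℝ) ^ (-(1 / 2) : ℝ)) := by
    rw [hs, Real.div_rpow hn0.le (by positivity), Real.mul_rpow hD0.le (by positivity),
      ← Real.rpow_mul hR.le, Real.rpow_neg hn0.le, Real.rpow_sub hR, Real.rpow_one,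
      show -γ * (1 / 2) = -(γ / 2) by ring, Real.rpow_neg hR.le]
    have h2 : 0 < R ^ (γ / 2) := by positivity
    have h3 : 0 < (n : ℝ) ^ (1 / 2 : ℝ) := by positivity
    have h4 : 0 < D ^ (1 / 2 : ℝ) := by positivity
    field_simp
  rw [h1, mul_assoc]

end Entropy

/-! ### Change of measure and the basic inequality -/

section LeastSquares

variable {𝓧 Ω : Type*} [MeasurableSpace 𝓧] [MeasurableSpace Ω] {P Q : Measure 𝓧} {μ : Measure Ω}

theorem le_smul_of_likelihoodRatio_le [IsFiniteMeasure P] [SigmaFinite Q] (hPQ : P ≪ Q)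
    {gs : 𝓧 → ℝ} {K : ℝ} (hgs : gs =ᵐ[Q] likelihoodRatio P Q) (hK : ∀ x, gs x ≤ K) :
    P ≤ ENNReal.ofReal K • Q := by
  have h1 : P.rnDeriv Q ≤ᵐ[Q] fun _ => ENNReal.ofReal K := by
    filter_upwards [hgs, P.rnDeriv_lt_top Q] with x hx hlt
    rw [← ENNReal.ofReal_toReal hlt.ne]
    refine ENNReal.ofReal_le_ofReal ?_
    have := hK x
    rw [hx] at this
    exact this
  have h2 := withDensity_mono h1
  rwa [Measure.withDensity_rnDeriv_eq P Q hPQ, withDensity_const] at h2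

theorem integral_eq_integral_mul_of_likelihoodRatio [SigmaFinite P] [SigmaFinite Q] (hPQ : P ≪ Q)
    {gs : 𝓧 → ℝ} (hgs : gs =ᵐ[Q] likelihoodRatio P Q) (h : 𝓧 → ℝ) :
    ∫ x, h x ∂P = ∫ x, gs x * h x ∂Q := by
  rw [← integral_rnDeriv_smul hPQ]
  refine integral_congr_ae ?_
  filter_upwards [hgs] with x hx
  rw [hx]
  rfl

theorem chiSqDist_congr {g₀ gs : 𝓧 → ℝ} (hgs : gs =ᵐ[Q] g₀) (g : 𝓧 → ℝ) :
    chiSqDist Q g₀ g = ∫ x, (g x - gs x) ^ 2 ∂Q := by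
  refine integral_congr_ae ?_
  filter_upwards [hgs] with x hx
  rw [hx]

/-- The basic inequality for the least-squares estimator. -/
theorem chiSqDist_le_empiricalDeviation [IsProbabilityMeasure P] [IsProbabilityMeasure Q]
    (hPQ : P ≪ Q) {G : Set (𝓧 → ℝ)} {gs g : 𝓧 → ℝ} {K : ℝ} (hGm : ∀ g ∈ G, Measurable g)
    (hGK : ∀ g ∈ G, ∀ x, |g x| ≤ K) (hgsG : gs ∈ G) (hgs : gs =ᵐ[Q] likelihoodRatio P Q)
    {x y : ℕ → 𝓧} {n : ℕ} (hg : IsChiSqEstimate G x y n g) :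
    chiSqDist Q (likelihoodRatio P Q) g ≤
      |empiricalDeviation Q y n (fun t => g t ^ 2 - gs t ^ 2)|
      + 2 * |empiricalDeviation P x n (fun t => g t - gs t)| := by
  obtain ⟨hgG, hmax⟩ := hg
  have hmul : ∀ g₁ ∈ G, ∀ g₂ ∈ G, Integrable (fun t => g₁ t * g₂ t) Q := fun g₁ h₁ g₂ h₂ =>
    integrable_of_abs_le (b := K * K) ((hGm _ h₁).mul (hGm _ h₂)) fun t => by
      rw [abs_mul]
      exact mul_le_mul (hGK _ h₁ t) (hGK _ h₂ t) (abs_nonneg _)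
        ((abs_nonneg _).trans (hGK _ h₁ t))
  have hsq : ∀ g ∈ G, Integrable (fun t => g t ^ 2) Q := fun g h => by
    simpa only [sq] using hmul g h g h
  have hiP : ∀ g ∈ G, Integrable g P := fun g h => integrable_of_abs_le (hGm g h) (hGK g h)
  have e1 : chiSqDist Q (likelihoodRatio P Q) g
      = ∫ t, g t ^ 2 ∂Q - 2 * ∫ t, gs t * g t ∂Q + ∫ t, gs t ^ 2 ∂Q := by
    rw [chiSqDist_congr hgs]
    have : (fun t => (g t - gs t) ^ 2) = fun t => g t ^ 2 - 2 * (gs t * g t) + gs t ^ 2 := by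
      ext t; ring
    have i1 : Integrable (fun t => 2 * (gs t * g t)) Q := (hmul gs hgsG g hgG).const_mul 2
    have i2 : Integrable (fun t => g t ^ 2 - 2 * (gs t * g t)) Q := (hsq g hgG).sub i1
    rw [this, integral_add i2 (hsq gs hgsG), integral_sub (hsq g hgG) i1, integral_const_mul]
  -- The change of measure turns the cross term of the squared distance into a `P`-expectation,
  -- which the criterion estimates.
  have e2 : ∫ t, g t ∂P = ∫ t, gs t * g t ∂Q :=
    integral_eq_integral_mul_of_likelihoodRatio hPQ hgs g
  have e3 : ∫ t, gs t ∂P = ∫ t, gs t ^ 2 ∂Q := by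
    rw [integral_eq_integral_mul_of_likelihoodRatio hPQ hgs gs]
    simp only [sq]
  have e4 : empiricalDeviation Q y n (fun t => g t ^ 2 - gs t ^ 2)
      = empiricalMean y n (fun t => g t ^ 2) - empiricalMean y n (fun t => gs t ^ 2)
        - (∫ t, g t ^ 2 ∂Q - ∫ t, gs t ^ 2 ∂Q) := by
    unfold empiricalDeviation empiricalMean
    rw [integral_sub (hsq g hgG) (hsq gs hgsG), Finset.sum_sub_distrib, mul_sub]
  have e5 : 2 * empiricalDeviation P x n (fun t => g t - gs t)
      = empiricalMean x n (fun t => 2 * g t) - empiricalMean x n (fun t => 2 * gs t)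
        - 2 * (∫ t, g t ∂P - ∫ t, gs t ∂P) := by
    unfold empiricalDeviation empiricalMean
    rw [integral_sub (hiP g hgG) (hiP gs hgsG), Finset.sum_sub_distrib, ← Finset.mul_sum,
      ← Finset.mul_sum]
    ring
  have hbasic : chiSqCriterion x y n gs ≤ chiSqCriterion x y n g := hmax hgsG
  unfold chiSqCriterion at hbasic
  have a1 := neg_abs_le (empiricalDeviation Q y n (fun t => g t ^ 2 - gs t ^ 2))
  have a2 := le_abs_self (empiricalDeviation P x n (fun t => g t - gs t))
  linarith

end LeastSquares

/-! ### Dyadic shells and Markov's inequality -/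

section Peeling

variable {Ω : Type*} [MeasurableSpace Ω] {μ : Measure Ω}

theorem measure_lt_le_tsum_dyadic {D : Ω → ℝ} {ρ : ℝ} (hρ : 0 < ρ) :
    μ {ω | ρ ^ 2 < D ω} ≤ ∑' s : ℕ, μ {ω | (ρ * 2 ^ s) ^ 2 ≤ D ω ∧ D ω ≤ (2 * (ρ * 2 ^ s)) ^ 2} := by
  refine le_trans (measure_mono fun ω hω => ?_) (measure_iUnion_le _)
  have hω' : ρ ^ 2 < D ω := hω
  obtain ⟨s, h1, h2⟩ := exists_nat_pow_near (x := D ω / ρ ^ 2) (y := 4)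
    ((one_le_div (by positivity)).mpr hω'.le) (by norm_num)
  rw [le_div_iff₀ (by positivity)] at h1
  rw [div_lt_iff₀ (by positivity)] at h2
  have h4 : ((2 : ℝ) ^ s) ^ 2 = 4 ^ s := by rw [← pow_mul, mul_comm, pow_mul]; norm_num
  refine Set.mem_iUnion.mpr ⟨s, ?_, ?_⟩
  · rw [mul_pow, h4]; linarith
  · rw [mul_pow, mul_pow, h4]
    rw [pow_succ] at h2
    linarith

theorem measure_le_ofReal_integral_div [IsFiniteMeasure μ] {W : Ω → ℝ} {a : ℝ} (ha : 0 < a)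
    (hW0 : ∀ ω, 0 ≤ W ω) (hW : Integrable W μ) :
    μ {ω | a ≤ W ω} ≤ ENNReal.ofReal ((∫ ω, W ω ∂μ) / a) := by
  have h := mul_meas_ge_le_integral_of_nonneg (Eventually.of_forall hW0) hW a
  rw [← ofReal_measureReal]
  refine ENNReal.ofReal_le_ofReal ?_
  rw [le_div_iff₀ ha]
  linarith

end Peeling

/-! ### The algebra of the rate -/

section Rate

theorem rpow_rate_mul_self {γ : ℝ} (hγ : 0 < γ) {n : ℕ} (hn : 1 ≤ n) :
    ((n : ℝ) ^ (-1 / (γ + 2))) ^ (2 + γ) * n = 1 := by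
  have hn0 : (0 : ℝ) < n := by positivity
  rw [← Real.rpow_mul hn0.le]
  have : -1 / (γ + 2) * (2 + γ) = -1 := by field_simp; ring
  rw [this, Real.rpow_neg_one, inv_mul_cancel₀ hn0.ne']

theorem rpow_rate_sq {γ : ℝ} {n : ℕ} (hn : 1 ≤ n) :
    ((n : ℝ) ^ (-1 / (γ + 2))) ^ 2 = (n : ℝ) ^ (-2 / (γ + 2)) := by
  have hn0 : (0 : ℝ) < n := by positivity
  rw [← Real.rpow_natCast, ← Real.rpow_mul hn0.le]
  congr 1
  push_cast
  ring

/-- The rate `x = n^(-1/(γ+2))` solves `x^(1 - γ/2) n^(-1/2) = x²`, so `n` cancels. The exponent `1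
- γ/2 < 1` leaves at most `4 K b / b²`, which is summable over `b = B 2^s`. -/
theorem modulus_div_sq_le {γ K b : ℝ} (hγ0 : 0 < γ) (hK : 1 ≤ K) (hb : 1 ≤ b)
    {n : ℕ} (hn : 1 ≤ n) :
    (4 * K * (b * (n : ℝ) ^ (-1 / (γ + 2)))) ^ (1 - γ / 2) * (n : ℝ) ^ (-(1 / 2) : ℝ)
      / (b * (n : ℝ) ^ (-1 / (γ + 2))) ^ 2 ≤ 4 * K / b := by
  have hn0 : (0 : ℝ) < n := by positivity
  have hb0 : 0 < b := by linarith
  have hK0 : 0 < K := by linarith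
  set x := (n : ℝ) ^ (-1 / (γ + 2)) with hx
  have hx0 : 0 < x := by positivity
  have h1 : x ^ (1 - γ / 2) * (n : ℝ) ^ (-(1 / 2) : ℝ) = x ^ 2 := by
    rw [rpow_rate_sq hn, hx, ← Real.rpow_mul hn0.le, ← Real.rpow_add hn0]
    congr 1
    field_simp
    ring
  have h2 : (4 * K * b) ^ (1 - γ / 2) ≤ 4 * K * b := by
    calc (4 * K * b) ^ (1 - γ / 2) ≤ (4 * K * b) ^ (1 : ℝ) :=
          Real.rpow_le_rpow_of_exponent_le (by nlinarith) (by linarith)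
      _ = 4 * K * b := Real.rpow_one _
  rw [← mul_assoc, Real.mul_rpow (by positivity) hx0.le, mul_assoc, h1,
    div_le_div_iff₀ (by positivity) hb0]
  have h3 := mul_le_mul_of_nonneg_right h2 (by positivity : 0 ≤ x ^ 2 * b)
  calc _ ≤ 4 * K * b * (x ^ 2 * b) := by linarith
    _ = _ := by ring

end Rate

/-! ### The rate of convergence -/

theorem theorem4 {𝓧 Ω : Type*} [MeasurableSpace 𝓧] [MeasurableSpace Ω]
    (P Q : Measure 𝓧) [IsProbabilityMeasure P] [IsProbabilityMeasure Q] (hPQ : P ≪ Q)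
    (μ : Measure Ω) [IsProbabilityMeasure μ]
    -- the two samples: `X i` i.i.d. from `P`, and `Y i` i.i.d. from `Q`
    (X Y : ℕ → Ω → 𝓧)
    (hX : ∀ i, HasLaw (X i) P μ) (hXindep : iIndepFun X μ)
    (hY : ∀ i, HasLaw (Y i) Q μ) (hYindep : iIndepFun Y μ)
    -- the class of candidate functions, which contains a version of the true likelihood ratio
    (G : Set (𝓧 → ℝ)) (hGmeas : ∀ g ∈ G, Measurable g) (hGnonneg : ∀ g ∈ G, ∀ x, 0 ≤ g x)
    (hGtrue : ∃ g ∈ G, g =ᵐ[Q] likelihoodRatio P Q)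
    -- uniform boundedness
    (K₂ : ℝ) (hGbound : ∀ g ∈ G, ∀ x, |g x| ≤ K₂)
    -- bracketing entropy
    (γ : ℝ) (hγ0 : 0 < γ) (hγ2 : γ < 2) (A : ℝ)
    (hGentropy : ∀ δ : ℝ, 0 < δ → bracketingEntropy G 2 Q δ ≤ ((A * δ ^ (-γ) : ℝ) : EReal))
    -- the estimator
    (gHat : ℕ → Ω → 𝓧 → ℝ)
    (hgHat : ∀ n : ℕ, 1 ≤ n →
      ∀ᵐ ω ∂μ, IsChiSqEstimate G (fun i => X i ω) (fun i => Y i ω) n (gHat n ω)) :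
    (∀ g ∈ G, Integrable (fun x => (g x - likelihoodRatio P Q x) ^ 2) Q) ∧
    IsBigOInProbability μ (fun n ω => chiSqDist Q (likelihoodRatio P Q) (gHat n ω))
      (fun n => (n : ℝ) ^ (-2 / (γ + 2))) := by
  obtain ⟨gs, hgsG, hgs⟩ := hGtrue
  set K := max K₂ 1 with hKdef
  have hK1 : 1 ≤ K := le_max_right _ _
  have hK0 : 0 < K := by linarith
  have hGK : ∀ g ∈ G, ∀ x, |g x| ≤ K := fun g hg x => (hGbound g hg x).trans (le_max_left _ _)
  have hdiffK : ∀ g ∈ G, ∀ x, (g x - gs x) ^ 2 ≤ (2 * K) ^ 2 := fun g hg x => by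
    rw [← sq_abs]
    refine pow_le_pow_left₀ (abs_nonneg _) ?_ 2
    linarith [abs_sub (g x) (gs x), hGK g hg x, hGK gs hgsG x]
  have hdiffi : ∀ g ∈ G, Integrable (fun x => (g x - gs x) ^ 2) Q := fun g hg =>
    integrable_of_abs_le (b := (2 * K) ^ 2) (((hGmeas g hg).sub (hGmeas gs hgsG)).pow_const 2)
      fun x => by rw [abs_of_nonneg (sq_nonneg _)]; exact hdiffK g hg x
  refine ⟨fun g hg => (hdiffi g hg).congr ?_, ?_⟩
  · filter_upwards [hgs] with x hx
    rw [hx]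
  have hPKQ : P ≤ ENNReal.ofReal K • Q :=
    le_smul_of_likelihoodRatio_le hPQ hgs fun x => (le_abs_self _).trans (hGK gs hgsG x)
  have hbrG : ∀ δ : ℝ, 0 < δ →
      ∃ N : ℕ, HasBracketing G 2 Q δ N ∧ (N : ℝ) ≤ Real.exp (A * δ ^ (-γ)) :=
    fun δ hδ => exists_hasBracketing_of_bracketingEntropy_le (hGentropy δ hδ)
  have hscale : ∀ δ : ℝ, 0 < δ →
      A * (δ / (2 * K)) ^ (-γ) = A * (2 * K) ^ γ * δ ^ (-γ) := fun δ hδ => by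
    rw [Real.div_rpow hδ.le (by positivity), Real.rpow_neg (x := 2 * K) (by positivity),
      div_inv_eq_mul]
    ring
  have hmulδ : ∀ δ : ℝ, 2 * K * (δ / (2 * K)) = δ := fun δ => by field_simp
  -- `M = 8 K²` is `4 K r` at `r = 2 K`, the largest shell that can be nonempty.
  obtain ⟨C₁, B₁, hC₁, hmodP⟩ := exists_modulus_of_entropy hX hXindep (F := G) hgsG
    (K := K) (A := A * (2 * K) ^ γ) (γ := γ) (M := 8 * K ^ 2) hGmeas hGK (by positivity) hK0.le
    hγ0 hγ2 (fun δ hδ => by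
      obtain ⟨N, hN, hNe⟩ := hbrG (δ / (2 * K)) (by positivity)
      have := hN.of_le_smul hK1 hPKQ
      rw [hmulδ] at this
      exact ⟨N, this, by rwa [hscale δ hδ] at hNe⟩)
  obtain ⟨C₂, B₂, hC₂, hmodQ⟩ := exists_modulus_of_entropy hY hYindep
    (F := (fun g x => g x ^ 2) '' G) (Set.mem_image_of_mem _ hgsG)
    (K := K ^ 2) (A := A * (2 * K) ^ γ) (γ := γ) (M := 8 * K ^ 2)
    (by rintro _ ⟨g, hg, rfl⟩; exact (hGmeas g hg).pow_const 2)
    (by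
      rintro _ ⟨g, hg, rfl⟩ t
      beta_reduce
      rw [abs_pow]; exact pow_le_pow_left₀ (abs_nonneg _) (hGK g hg t) 2)
    (by positivity) (by positivity) hγ0 hγ2 (fun δ hδ => by
      obtain ⟨N, hN, hNe⟩ := hbrG (δ / (2 * K)) (by positivity)
      have := hN.sq hK0.le (by positivity) hGnonneg hGK
      rw [hmulδ] at this
      exact ⟨N, this, by rwa [hscale δ hδ] at hNe⟩)
  -- One radius `4 K r` serves both processes: here `dP/dQ ≤ K` gives `4 K r²`, at most `(4 K r)²`
  -- as `K ≥ 1`; in `hdistQ` the Lipschitz constant `2 K` gives it exactly.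
  have hdistP : ∀ g ∈ G, ∀ r : ℝ, 0 < r → ∫ x, (g x - gs x) ^ 2 ∂Q ≤ (2 * r) ^ 2 →
      ∫ x, (g x - gs x) ^ 2 ∂P ≤ (4 * K * r) ^ 2 := by
    intro g hg r hr h
    rw [integral_eq_integral_mul_of_likelihoodRatio hPQ hgs]
    have h1 : ∫ x, gs x * (g x - gs x) ^ 2 ∂Q ≤ ∫ x, K * (g x - gs x) ^ 2 ∂Q :=
      integral_mono_of_nonneg
        (Eventually.of_forall fun x => mul_nonneg (hGnonneg gs hgsG x) (sq_nonneg _))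
        ((hdiffi g hg).const_mul K)
        (Eventually.of_forall fun x => mul_le_mul_of_nonneg_right
          ((le_abs_self _).trans (hGK gs hgsG x)) (sq_nonneg _))
    rw [integral_const_mul] at h1
    have h2 := mul_le_mul_of_nonneg_left h hK0.le
    have h3 : K * (2 * r) ^ 2 ≤ (4 * K * r) ^ 2 := by
      have : 0 ≤ K * r ^ 2 := by positivity
      nlinarith
    linarith
  have hdistQ : ∀ g ∈ G, ∀ r : ℝ, 0 < r → ∫ x, (g x - gs x) ^ 2 ∂Q ≤ (2 * r) ^ 2 →
      ∫ x, (g x ^ 2 - gs x ^ 2) ^ 2 ∂Q ≤ (4 * K * r) ^ 2 := by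
    intro g hg r hr h
    have h1 : ∫ x, (g x ^ 2 - gs x ^ 2) ^ 2 ∂Q ≤ ∫ x, (2 * K) ^ 2 * (g x - gs x) ^ 2 ∂Q :=
      integral_mono_of_nonneg (Eventually.of_forall fun x => sq_nonneg _)
        ((hdiffi g hg).const_mul _) (Eventually.of_forall fun x => by
          have h2 : g x + gs x ≤ 2 * K := by
            linarith [le_abs_self (g x), le_abs_self (gs x), hGK g hg x, hGK gs hgsG x]
          have h3 : 0 ≤ g x + gs x := add_nonneg (hGnonneg g hg x) (hGnonneg gs hgsG x)
          calc (g x ^ 2 - gs x ^ 2) ^ 2 = (g x + gs x) ^ 2 * (g x - gs x) ^ 2 := by ring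
            _ ≤ (2 * K) ^ 2 * (g x - gs x) ^ 2 :=
              mul_le_mul_of_nonneg_right (pow_le_pow_left₀ h3 h2 2) (sq_nonneg _))
    rw [integral_const_mul] at h1
    have h2 := mul_le_mul_of_nonneg_left h (by positivity : 0 ≤ (2 * K) ^ 2)
    calc _ ≤ _ := h1.trans h2
      _ = _ := by ring
  intro ε hε
  set D := C₂ + 2 * C₁ with hD
  have hD0 : 0 < D := by positivity
  -- The last summand makes the sum `8 K D / B` of the shell bounds at most `ε`; the others meet the
  -- conditions of the two moduli.
  set B := 1 + |B₁| + |B₂| + 8 * K * D / ε with hB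
  have hBε : 0 < 8 * K * D / ε := by positivity
  have hB1 : 1 ≤ B := by linarith [abs_nonneg B₁, abs_nonneg B₂]
  have hBB₁ : B₁ ≤ B := by linarith [le_abs_self B₁, abs_nonneg B₂]
  have hBB₂ : B₂ ≤ B := by linarith [le_abs_self B₂, abs_nonneg B₁]
  have hB0 : 0 < B := by linarith
  refine ⟨B ^ 2, by positivity, fun n hn => ?_⟩
  have hn0 : (0 : ℝ) < n := by positivity
  set x := (n : ℝ) ^ (-1 / (γ + 2)) with hx
  have hx0 : 0 < x := by positivity
  set d : Ω → ℝ := fun ω => |chiSqDist Q (likelihoodRatio P Q) (gHat n ω)| with hd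
  have hshell : ∀ s : ℕ, μ {ω | (B * x * 2 ^ s) ^ 2 ≤ d ω ∧ d ω ≤ (2 * (B * x * 2 ^ s)) ^ 2}
      ≤ ENNReal.ofReal (4 * K * D / B * (1 / 2) ^ s) := by
    intro s
    set b := B * 2 ^ s with hb
    have h2s : (1 : ℝ) ≤ 2 ^ s := one_le_pow₀ (by norm_num)
    have hb1 : 1 ≤ b := one_le_mul_of_one_le_of_one_le hB1 h2s
    have hBb : B ≤ b := le_mul_of_one_le_right hB0.le h2s
    have hb0 : 0 < b := by linarith
    rw [show B * x * 2 ^ s = b * x by rw [hb]; ring]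
    have hr0 : 0 < b * x := by positivity
    have hdω : ∀ ω, gHat n ω ∈ G → d ω = ∫ t, (gHat n ω t - gs t) ^ 2 ∂Q := fun ω _ => by
      have h1 := chiSqDist_congr hgs (gHat n ω)
      simp only [hd, h1]
      exact abs_of_nonneg (integral_nonneg fun t => sq_nonneg _)
    -- Shells beyond `2 K` are null, since `|ĝ - gs| ≤ 2 K` almost surely; on the others the radius
    -- stays below `M`.
    rcases lt_or_ge (2 * K) (b * x) with hbig | hsmall
    · refine le_trans (le_of_eq ?_) zero_le
      rw [measure_eq_zero_iff_ae_notMem]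
      filter_upwards [hgHat n hn] with ω hω hmem
      have h1 : (b * x) ^ 2 ≤ ∫ t, (gHat n ω t - gs t) ^ 2 ∂Q := (hdω ω hω.1) ▸ hmem.1
      have h2 : ∫ t, (gHat n ω t - gs t) ^ 2 ∂Q ≤ ∫ _, (2 * K) ^ 2 ∂Q :=
        integral_mono (hdiffi _ hω.1) (integrable_const _) (hdiffK _ hω.1)
      have h3 : (2 * K) ^ 2 < (b * x) ^ 2 := pow_lt_pow_left₀ hbig (by positivity) two_ne_zero
      simp only [integral_const, probReal_univ, smul_eq_mul, one_mul] at h2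
      linarith
    · have hR0 : 0 < 4 * K * (b * x) := by positivity
      have hRM : 4 * K * (b * x) ≤ 8 * K ^ 2 := by nlinarith
      have hBR : B ≤ (4 * K * (b * x)) ^ (2 + γ) * n := by
        rw [← mul_assoc (4 * K), Real.mul_rpow (by positivity) hx0.le, mul_assoc,
          rpow_rate_mul_self hγ0 hn, mul_one]
        have h1 : 1 ≤ 4 * K * b := by nlinarith
        calc B ≤ 4 * K * b := by nlinarith
          _ = (4 * K * b) ^ (1 : ℝ) := (Real.rpow_one _).symm
          _ ≤ (4 * K * b) ^ (2 + γ) := Real.rpow_le_rpow_of_exponent_le h1 (by linarith)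
      obtain ⟨W₁, hW₁i, hW₁, hW₁e⟩ := hmodP n hn _ hR0 hRM (hBB₁.trans hBR)
      obtain ⟨W₂, hW₂i, hW₂, hW₂e⟩ := hmodQ n hn _ hR0 hRM (hBB₂.trans hBR)
      have hW₁0 : ∀ ω, 0 ≤ W₁ ω := fun ω =>
        (abs_nonneg _).trans (hW₁ gs hgsG (by simp; positivity) ω)
      have hW₂0 : ∀ ω, 0 ≤ W₂ ω := fun ω =>
        (abs_nonneg _).trans (hW₂ _ (Set.mem_image_of_mem _ hgsG) (by simp; positivity) ω)
      have hWi : Integrable (fun ω => W₂ ω + 2 * W₁ ω) μ := hW₂i.add (hW₁i.const_mul 2)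
      have hWe : ∫ ω, (W₂ ω + 2 * W₁ ω) ∂μ
          ≤ D * ((4 * K * (b * x)) ^ (1 - γ / 2) * (n : ℝ) ^ (-(1 / 2) : ℝ)) := by
        rw [integral_add hW₂i (hW₁i.const_mul 2), integral_const_mul, hD, add_mul]
        linarith
      -- On the shell the basic inequality forces the dominating variables to be large. Passing to
      -- `W₂ + 2 W₁` lets Markov's inequality apply without any measurability of `ĝ`.
      have hsub : μ {ω | (b * x) ^ 2 ≤ d ω ∧ d ω ≤ (2 * (b * x)) ^ 2}
          ≤ μ {ω | (b * x) ^ 2 ≤ W₂ ω + 2 * W₁ ω} := by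
        refine measure_mono_ae ?_
        filter_upwards [hgHat n hn] with ω hω hmem
        have h1 : (b * x) ^ 2 ≤ d ω := hmem.1
        have h2 : d ω ≤ (2 * (b * x)) ^ 2 := hmem.2
        have h3 := chiSqDist_le_empiricalDeviation hPQ hGmeas hGK hgsG hgs hω
        have h4 : d ω = chiSqDist Q (likelihoodRatio P Q) (gHat n ω) := by
          rw [hdω ω hω.1, chiSqDist_congr hgs]
        rw [hdω ω hω.1] at h2
        have h5 := hW₁ _ hω.1 (hdistP _ hω.1 _ hr0 h2) ω
        have h6 := hW₂ _ (Set.mem_image_of_mem _ hω.1) (hdistQ _ hω.1 _ hr0 h2) ω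
        change (b * x) ^ 2 ≤ W₂ ω + 2 * W₁ ω
        linarith
      refine hsub.trans ((measure_le_ofReal_integral_div (by positivity)
        (fun ω => by linarith [hW₁0 ω, hW₂0 ω]) hWi).trans (ENNReal.ofReal_le_ofReal ?_))
      have h1 := modulus_div_sq_le hγ0 hK1 hb1 hn
      calc (∫ ω, (W₂ ω + 2 * W₁ ω) ∂μ) / (b * x) ^ 2
          ≤ D * ((4 * K * (b * x)) ^ (1 - γ / 2) * (n : ℝ) ^ (-(1 / 2) : ℝ)) / (b * x) ^ 2 :=
            div_le_div_of_nonneg_right hWe (by positivity)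
        _ = D * ((4 * K * (b * x)) ^ (1 - γ / 2) * (n : ℝ) ^ (-(1 / 2) : ℝ) / (b * x) ^ 2) :=
            mul_div_assoc _ _ _
        _ ≤ D * (4 * K / b) := mul_le_mul_of_nonneg_left h1 hD0.le
        _ = 4 * K * D / B * (1 / 2) ^ s := by
            rw [hb, one_div, inv_pow]; field_simp
  have hset : B ^ 2 * (n : ℝ) ^ (-2 / (γ + 2)) = (B * x) ^ 2 := by
    rw [mul_pow, hx, rpow_rate_sq hn]
  change μ {ω | B ^ 2 * (n : ℝ) ^ (-2 / (γ + 2)) < d ω} ≤ _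
  rw [hset]
  refine (measure_lt_le_tsum_dyadic (by positivity)).trans ((ENNReal.tsum_le_tsum hshell).trans ?_)
  rw [← ENNReal.ofReal_tsum_of_nonneg (fun s => by positivity)
    (summable_geometric_two.mul_left _), tsum_mul_left, tsum_geometric_two]
  refine ENNReal.ofReal_le_ofReal ?_
  rw [div_mul_eq_mul_div, div_le_iff₀ hB0]
  have h1 : 8 * K * D / ε ≤ B := by linarith [abs_nonneg B₁, abs_nonneg B₂]
  rw [div_le_iff₀ hε] at h1
  linarith
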